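/- Let $d\ge 2$, let $S\subset\mathbb{R}^d$ be a finite set of at least two points in general position (no affinely dependent subset of $S$ lies on the boundary of a ball), and let $\nu:[0,T]\to\mathbb{R}^d$, $T>0$, be a rational parametric curve without poles on $[0,T]$, the motion of a mobile point. For a finite nonempty set $P$ let $SEB(P)$ be its smallest enclosing ball; write $B=SEB(S)$. The \emph{1-center function} is $\varepsilon(t)=$ the center of $SEB(S\cup\{\nu(t)\})$, $t\in[0,T]$. For $S'=\{s_1,\dots,s_k\}\subseteq S$ let $\xi(S',\nu)$ be the rational parametric curve $$\xi(S',\nu)=\nu+\sum_{j=1}^k\frac{\det M_j}{\det M}(s_j-\nu),\qquad M=\big((s_i-\nu)\cdot(s_j-\nu)\big)_{i,j},$$ where $M_j$ is $M$ with its $j$-th column replaced by $\big(\tfrac12(s_i-\nu)\cdot(s_i-\nu)\big)_i$, all rational functions being taken in reduced form; it is the circumcenter of $S'\cup\{\nu\}$. For $P\subseteq S$ the farthest-point Voronoi face $\mathcal F(P)$ is the set of the points that are equidistant from all points of $P$ and closer to every point of $S\setminus P$. An \emph{intersection} of two rational curves, or of a rational curve with a set, is a parameter value that is an isolated point of the set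 of parameters at which they coincide, respectively at which the curve lies in the set (the curves being defined there). An \emph{IN-point} (\emph{OUT-point}) is a parameter $t_0$ with $\nu(t_0)\in\partial B$ such that $\nu$ is outside $B$ just before and in the interior of $B$ just after $t_0$ (in the interior just before and outside just after); here the rational functions $\nu$ are considered also slightly beyond $[0,T]$. A set $S'$ is a \emph{support set} for a position $x$ of the mobile point if $\emptyset\ne S'\subseteq S$, $x\notin S'$, the points of $U=S'\cup\{x\}$ are affinely independent, their circumball (the smallest ball with $U$ on its boundary) contains $S$, and its center lies in $\operatorname{conv}(U)$. Given $B$, the farthest-point Voronoi diagram of $S$, the first arc, and a number $\epsilon>0$, consider the following algorithm, which produces a list of event points, each with the arc that starts there. (0) The first event point is $0$. If $\nu(t)$ is in the interior of $B$ for all small $t>0$, the first arc is the constant arc, equal to the center of $B$. Otherwise it is $\xi(S',\nu)$ for a given $S'$ that is a support set for $\nu(t)$ for all small $t>0$. (1) Let $e$ be the last event point. If the present arc is constant, the candidates for the next event point are the OUT-points in $(e,T]$. If it is $\xi(S',\nu)$, the candidates are the IN-points, the intersections of $\xi(S',\nu)$ with $\xi(S'',\nu)$, $\emptyset\neq S''\subsetneq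 S'$, and the intersections of $\xi(S',\nu)$ with the faces $\mathcal F(P)$, $S'\subsetneq P\subseteq S$, in $(e,T]$. The next event point is the earliest candidate. (2) If there is no candidate, end. If the new event point $t$ is an IN-point, the new arc is the constant arc. Otherwise the new arc is $\xi(S',\nu)$, where $S'$ is any support set for $\nu(t+\epsilon)$. Go to (1). Then a first arc as in (0) exists, and there is $\epsilon_0>0$ such that for every $\epsilon\in(0,\epsilon_0)$, and whatever choices of support sets are made: every iteration can be carried out unless the algorithm ends; the algorithm terminates, with a bound on the number of iterations; and its output is the piecewise parametric equation of the 1-center function, that is, the intervals between consecutive event points (and from the last one to $T$) cover $[0,T]$, and on each of these closed intervals the corresponding arc has no pole and equals $\varepsilon(t)$. -/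

import Mathlib

open Filter Topology

noncomputable section

namespace OneCenter

/-- The ambient Euclidean space `ℝ^d`. -/
abbrev Pt (d : ℕ) := EuclideanSpace ℝ (Fin d)

/-! ### Balls, general position, Voronoi faces -/

/-- `closedBall c r` is the smallest enclosing ball of the (nonempty) set `P`. -/
def IsSEB {d : ℕ} (P : Set (Pt d)) (c : Pt d) (r : ℝ) : Prop :=
  P ⊆ Metric.closedBall c r ∧
    ∀ (c' : Pt d) (r' : ℝ), P ⊆ Metric.closedBall c' r' → r ≤ r'

/-- `closedBall c r` is the circumball of the (nonempty) set `P`: the smallest ball that has all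
points of `P` on its boundary. -/
def IsCircumball {d : ℕ} (P : Set (Pt d)) (c : Pt d) (r : ℝ) : Prop :=
  P ⊆ Metric.sphere c r ∧
    ∀ (c' : Pt d) (r' : ℝ), P ⊆ Metric.sphere c' r' → r ≤ r'

/-- No affinely dependent subset of `P` lies on the boundary of a ball. -/
def GeneralPosition {d : ℕ} (P : Set (Pt d)) : Prop :=
  ∀ (Q : Set (Pt d)), Q ⊆ P → ∀ (c : Pt d) (r : ℝ), Q ⊆ Metric.sphere c r →
    AffineIndependent ℝ (fun x : Q => (x : Pt d))

/-- The farthest-point Voronoi face `F(P)` of the diagram of `S` that is defined by `P ⊆ S`: the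
points equidistant from all points of `P` and closer to all other points of `S`. -/
def voronoiFace {d : ℕ} (S P : Finset (Pt d)) : Set (Pt d) :=
  {x | (∀ p ∈ P, ∀ p' ∈ P, dist x p = dist x p') ∧
    ∀ p ∈ P, ∀ l ∈ S, l ∉ P → dist x l < dist x p}

/-! ### Rational parametric curves -/

/-- A rational parametric curve: every coordinate is a rational function of the parameter. -/
abbrev RatCurve (d : ℕ) := Fin d → RatFunc ℝ

namespace RatCurve

/-- The parameter `t` is not a pole of the curve. -/
def DefinedAt {d : ℕ} (γ : RatCurve d) (t : ℝ) : Prop :=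
  ∀ i, (γ i).denom.eval t ≠ 0

/-- The point of the curve at the parameter `t` (meaningful if `t` is not a pole). -/
def point {d : ℕ} (γ : RatCurve d) (t : ℝ) : Pt d :=
  WithLp.toLp 2 fun i => (γ i).eval (RingHom.id ℝ) t

/-- The constant curve. -/
def const {d : ℕ} (c : Pt d) : RatCurve d := fun i => RatFunc.C (c i)

end RatCurve

/-- The Gram matrix `((sᵢ - ν) · (sⱼ - ν))ᵢⱼ` of the static points in `S'`, based at the mobile
point `ν`, with rational functions of the parameter as entries. -/
def gram {d : ℕ} (S' : Finset (Pt d)) (ν : RatCurve d) : Matrix S' S' (RatFunc ℝ) :=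
  fun i j => ∑ k, (RatFunc.C ((i : Pt d) k) - ν k) * (RatFunc.C ((j : Pt d) k) - ν k)

open scoped Classical in
/-- The curve `ξ(S', ν)`, the circumcenter of the simplex with vertices `ν, s₁, …, s_k`
(`S' = {s₁, …, s_k}`), as a rational parametric curve:
`ξ = ν + ∑ⱼ (det Mⱼ / det M) (sⱼ - ν)`, where `M` is the Gram matrix and `Mⱼ` is `M` with
its `j`-th column replaced by `((sᵢ - ν) · (sᵢ - ν) / 2)ᵢ`. -/
def circumcenterCurve {d : ℕ} (S' : Finset (Pt d)) (ν : RatCurve d) : RatCurve d := fun k =>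
  ν k + ∑ j : S',
    (((gram S' ν).updateCol j fun i => gram S' ν i i / 2).det / (gram S' ν).det) *
      (RatFunc.C ((j : Pt d) k) - ν k)

/-! ### Intersections -/

/-- `t₀` is an isolated point of the set `A` of parameters. Intersections are isolated
coincidences: where two curves are identical, or a curve runs inside a face, there is no
intersection. -/
def IsIsolated (A : Set ℝ) (t₀ : ℝ) : Prop :=
  t₀ ∈ A ∧ ∀ᶠ t in 𝓝[≠] t₀, t ∉ A

/-- `t₀` is an intersection of the two rational curves. -/
def CurvesMeetAt {d : ℕ} (γ δ : RatCurve d) (t₀ : ℝ) : Prop :=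
  IsIsolated {t | γ.DefinedAt t ∧ δ.DefinedAt t ∧ γ.point t = δ.point t} t₀

/-- `t₀` is an intersection of the rational curve with the set `F`. -/
def CurveMeetsSetAt {d : ℕ} (γ : RatCurve d) (F : Set (Pt d)) (t₀ : ℝ) : Prop :=
  IsIsolated {t | γ.DefinedAt t ∧ γ.point t ∈ F} t₀

/-- The mobile point enters the ball at `t₀` (tangential contacts do not count). -/
def IsInPoint {d : ℕ} (o : Pt d) (R : ℝ) (ν : RatCurve d) (t₀ : ℝ) : Prop :=
  ν.point t₀ ∈ Metric.sphere o R ∧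
    (∀ᶠ t in 𝓝[<] t₀, ν.point t ∉ Metric.closedBall o R) ∧
    (∀ᶠ t in 𝓝[>] t₀, ν.point t ∈ Metric.ball o R)

/-- The mobile point exits the ball at `t₀` (tangential contacts do not count). -/
def IsOutPoint {d : ℕ} (o : Pt d) (R : ℝ) (ν : RatCurve d) (t₀ : ℝ) : Prop :=
  ν.point t₀ ∈ Metric.sphere o R ∧
    (∀ᶠ t in 𝓝[<] t₀, ν.point t ∈ Metric.ball o R) ∧
    (∀ᶠ t in 𝓝[>] t₀, ν.point t ∉ Metric.closedBall o R)

/-! ### The algorithm -/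

/-- The kind of an arc of the center function: either the mobile point is inside the smallest
enclosing ball of the static points and the arc is constant, or the arc is `ξ(S', ν)`. -/
inductive ArcKind (d : ℕ) where
  | inside : ArcKind d
  | outside (S' : Finset (Pt d)) : ArcKind d

/-- The parametric equation of an arc; `o` is the center of the smallest enclosing ball of the
static points. -/
def ArcKind.curve {d : ℕ} (o : Pt d) (ν : RatCurve d) : ArcKind d → RatCurve d
  | .inside => RatCurve.const o
  | .outside S' => circumcenterCurve S' ν

/-- The test by which a support set is found when the mobile point is at `x`: the points of
`U = S' ∪ {x}` are affinely independent, the circumball of `U` contains `S`, and its center lies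
in the convex hull of `U`. -/
def IsSupport {d : ℕ} (S S' : Finset (Pt d)) (x : Pt d) : Prop :=
  S' ⊆ S ∧ S'.Nonempty ∧ x ∉ S' ∧
    AffineIndependent ℝ (fun y : (insert x (S' : Set (Pt d)) : Set (Pt d)) => (y : Pt d)) ∧
    ∃ c r, IsCircumball (insert x (S' : Set (Pt d))) c r ∧
      (S : Set (Pt d)) ⊆ Metric.closedBall c r ∧
      c ∈ convexHull ℝ (insert x (S' : Set (Pt d)))

/-- The first arc, which is part of the input: the event point `0` is an IN-point if the
mobile point is in the interior of the ball of `S` at the beginning; otherwise the support set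
`S'` at the beginning is given. -/
def IsFirstArc {d : ℕ} (S : Finset (Pt d)) (o : Pt d) (R : ℝ) (ν : RatCurve d) :
    ArcKind d → Prop
  | .inside => ∀ᶠ t in 𝓝[>] (0 : ℝ), ν.point t ∈ Metric.ball o R
  | .outside S' => ∀ᶠ t in 𝓝[>] (0 : ℝ), IsSupport S S' (ν.point t)

/-- The intersections that are computed while the given arc is the present one. On a constant
arc: the OUT-points. On an arc `ξ(S', ν)`: the IN-points, the intersections with the curves
`ξ(S'', ν)` for nonempty `S'' ⊊ S'`, and those with the Voronoi faces `F(P)`, `S' ⊊ P ⊆ S`. -/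
def IsCandidate {d : ℕ} (S : Finset (Pt d)) (o : Pt d) (R : ℝ) (ν : RatCurve d) :
    ArcKind d → ℝ → Prop
  | .inside, t => IsOutPoint o R ν t
  | .outside S', t =>
      IsInPoint o R ν t ∨
      (∃ S'' : Finset (Pt d), S''.Nonempty ∧ S'' ⊂ S' ∧
        CurvesMeetAt (circumcenterCurve S'' ν) (circumcenterCurve S' ν) t) ∨
      (∃ P : Finset (Pt d), S' ⊂ P ∧ P ⊆ S ∧
        CurveMeetsSetAt (circumcenterCurve S' ν) (voronoiFace S P) t)

/-- The arc chosen at the event point `t`: the constant arc at an IN-point, and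
otherwise an arc `ξ(S', ν)` whose support set `S'` is found at the perturbed time `t + ε`. -/
def IsNextArc {d : ℕ} (S : Finset (Pt d)) (o : Pt d) (R : ℝ) (ν : RatCurve d) (ε t : ℝ) :
    ArcKind d → Prop
  | .inside => IsInPoint o R ν t
  | .outside S' => ¬ IsInPoint o R ν t ∧ IsSupport S S' (ν.point (t + ε))

/-- The candidates for the next event point after the event point `e.1` with arc `e.2`. -/
def nextCandidates {d : ℕ} (S : Finset (Pt d)) (o : Pt d) (R : ℝ) (ν : RatCurve d) (T : ℝ)
    (e : ℝ × ArcKind d) : Set ℝ :=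
  {t | t ∈ Set.Ioc e.1 T ∧ IsCandidate S o R ν e.2 t}

/-- The (partial) executions of the algorithm on the time interval `[0, T]` with perturbation
parameter `ε`, recorded as the list of the event points found so far, each with the arc that
starts there, the most recent one first. -/
inductive Execution {d : ℕ} (S : Finset (Pt d)) (o : Pt d) (R : ℝ) (ν : RatCurve d)
    (T ε : ℝ) : List (ℝ × ArcKind d) → Prop
  | start (a : ArcKind d) (h : IsFirstArc S o R ν a) : Execution S o R ν T ε [(0, a)]
  | step (e : ℝ × ArcKind d) (l : List (ℝ × ArcKind d)) (t : ℝ) (a : ArcKind d)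
      (h : Execution S o R ν T ε (e :: l))
      (ht : IsLeast (nextCandidates S o R ν T e) t)
      (ha : IsNextArc S o R ν ε t a) : Execution S o R ν T ε ((t, a) :: e :: l)

/-- The list of event points and arcs (most recent first) is a piecewise parametric equation, on
`[0, T]`, of the 1-center function: each arc is defined on the whole closed interval from its
event point to the next one (or to `T`), and its point at `t` is the center of the smallest
enclosing ball of `S ∪ {ν(t)}` for all `t` there; the intervals cover `[0, T]`. -/
def IsOneCenterEquation {d : ℕ} (S : Finset (Pt d)) (o : Pt d) (ν : RatCurve d) :
    ℝ → List (ℝ × ArcKind d) → Prop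
  | T, [] => T = 0
  | T, e :: l => e.1 ≤ T ∧
      (∀ t ∈ Set.Icc e.1 T, (e.2.curve o ν).DefinedAt t ∧
        ∃ r, IsSEB (insert (ν.point t) (S : Set (Pt d))) ((e.2.curve o ν).point t) r) ∧
      IsOneCenterEquation S o ν e.1 l

end OneCenter

end

/-!
The mobile point has a support set whenever it is not in the interior of the ball `B` of `S`
(`exists_isSupport`): the dual of the smallest enclosing ball problem writes the center as a convex
combination of boundary points, and Carathéodory's theorem thins these out. All conditions
involved are sign conditions on rational functions of time, so that on each side of a parameter
each of them is eventually true or eventually false (`Decides`); in particular every arc has only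
finitely many candidates, and for small `ε` the time `t + ε` after a candidate `t` is
representative of the times shortly after `t` (`eventually_isSmall`).

The core is `eventually_isSupport_right`: a support set `S'` valid just before `t₀` is valid just
after it unless `t₀` is a candidate. Before `t₀` the affine coordinates of the center of the ball
lie in `[0, 1]`. Being bounded rational functions, they have no pole at `t₀`, even if the mobile
point touches `S'` there, and the curve still gives the center of the smallest enclosing ball. If
`S'` fails after `t₀`, then one of the following holds.
* The coordinate at some `s ∈ S'` becomes negative. It vanishes at `t₀`, and the curve meets
  `ξ(S'', ν)` for some nonempty `S'' ⊆ S' \ {s}` (`exists_curvesMeetAt`).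
* The coordinate at the mobile point becomes negative. The center is then the one of `B` at `t₀`,
  and an identity for the power of the mobile point with respect to `B` shows that the mobile
  point enters `B` (`isInPoint_of_one_lt_sum`).
* A point of `S` leaves the ball. The curve meets the Voronoi face of the points of `S` at maximal
  distance (`exists_curveMeetsSetAt`).

A continuity argument along the parameter (`eventually_arcValid_left`) extends the validity of an
arc up to the next candidate, and induction on the execution gives the theorem.
-/

open Filter Topology

noncomputable section

namespace OneCenter

/-! ### Weighted points and smallest enclosing balls -/

/-- Huygens' identity: the weighted mean square distance to `y` exceeds the one to the barycenter
by the squared distance from the barycenter to `y`. -/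
lemma sum_mul_dist_sq {E ι : Type*} [NormedAddCommGroup E] [InnerProductSpace ℝ E] [Fintype ι]
    (w : ι → ℝ) (p : ι → E) (hw : ∑ i, w i = 1) (c : E) (hc : ∑ i, w i • p i = c) (y : E) :
    ∑ i, w i * dist (p i) y ^ 2 = ∑ i, w i * dist (p i) c ^ 2 + dist c y ^ 2 := by
  have h0 : ∑ i, w i • (p i - c) = 0 := by
    simp only [smul_sub, Finset.sum_sub_distrib, hc, ← Finset.sum_smul, hw, one_smul, sub_self]
  have h1 : ∑ i, w i * inner ℝ (p i - c) (c - y) = 0 := by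
    have := congrArg (fun v => inner ℝ v (c - y)) h0
    simpa [sum_inner, inner_smul_left] using this
  have h2 : ∀ i, w i * dist (p i) y ^ 2 =
      w i * dist (p i) c ^ 2 + 2 * (w i * inner ℝ (p i - c) (c - y)) + w i * dist c y ^ 2 := by
    intro i
    have : p i - y = (p i - c) + (c - y) := by abel
    rw [dist_eq_norm, this, norm_add_sq_real, dist_eq_norm, dist_eq_norm]
    ring
  simp only [h2, Finset.sum_add_distrib, ← Finset.mul_sum, ← Finset.sum_mul, hw, h1]
  ring

/-- A ball whose center is a convex combination of points on its boundary is smaller than any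
ball that contains these points, quantitatively. -/
lemma sq_add_dist_sq_le {E ι : Type*} [NormedAddCommGroup E] [InnerProductSpace ℝ E] [Fintype ι]
    {w : ι → ℝ} {p : ι → E} {c c' : E} {r r' : ℝ} (hw : w ∈ stdSimplex ℝ ι)
    (hc : ∑ i, w i • p i = c) (hr : ∀ i, w i ≠ 0 → dist (p i) c = r)
    (h : ∀ i, w i ≠ 0 → dist (p i) c' ≤ r') : r ^ 2 + dist c c' ^ 2 ≤ r' ^ 2 := by
  have h1 := sum_mul_dist_sq w p hw.2 c hc c'
  have h2 : ∑ i, w i * dist (p i) c ^ 2 = r ^ 2 := by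
    rw [← one_mul (r ^ 2), ← hw.2, Finset.sum_mul]
    refine Finset.sum_congr rfl fun i _ => ?_
    by_cases hi : w i = 0
    · simp [hi]
    · rw [hr i hi]
  have h3 : ∑ i, w i * dist (p i) c' ^ 2 ≤ r' ^ 2 := by
    rw [← one_mul (r' ^ 2), ← hw.2, Finset.sum_mul]
    refine Finset.sum_le_sum fun i _ => ?_
    by_cases hi : w i = 0
    · simp [hi]
    · exact mul_le_mul_of_nonneg_left (pow_le_pow_left₀ dist_nonneg (h i hi) 2) (hw.1 i)
  linarith

/-- Every finite family has an enclosing ball whose center is a convex combination of points on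
its boundary. The weights maximize `∑ wᵢ ‖pᵢ‖² - ‖∑ wᵢ pᵢ‖²` on the standard simplex. -/
lemma exists_weights {E ι : Type*} [NormedAddCommGroup E] [InnerProductSpace ℝ E] [Fintype ι]
    [Nonempty ι] (p : ι → E) :
    ∃ w ∈ stdSimplex ℝ ι, ∃ r : ℝ, 0 ≤ r ∧ (∀ i, dist (p i) (∑ i, w i • p i) ≤ r) ∧
      ∀ i, w i ≠ 0 → dist (p i) (∑ i, w i • p i) = r := by
  classical
  obtain ⟨w, hw, hmax⟩ := (isCompact_stdSimplex ℝ ι).exists_isMaxOn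
    ⟨_, single_mem_stdSimplex ℝ (Classical.arbitrary ι)⟩
    (f := fun w => ∑ i, w i * ‖p i‖ ^ 2 - ‖∑ i, w i • p i‖ ^ 2) (by fun_prop)
  set c := ∑ i, w i • p i with hc
  set A := ∑ i, w i * ‖p i‖ ^ 2 with hA
  have hA0 : ∑ i, w i * dist (p i) c ^ 2 = A - ‖c‖ ^ 2 := by
    have := sum_mul_dist_sq w p hw.2 c rfl 0
    simp only [dist_zero_right] at this
    linarith
  have hnn : 0 ≤ A - ‖c‖ ^ 2 := by
    rw [← hA0]
    exact Finset.sum_nonneg fun i _ => mul_nonneg (hw.1 i) (sq_nonneg _)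
  -- first order optimality of `w` in the direction of the vertex `q`
  have key : ∀ q, dist (p q) c ^ 2 ≤ A - ‖c‖ ^ 2 := by
    intro q
    set D := ‖p q‖ ^ 2 - A - 2 * inner ℝ c (p q - c) with hD
    set N := ‖p q - c‖ ^ 2 with hN
    have hDN : dist (p q) c ^ 2 = D + (A - ‖c‖ ^ 2) := by
      have h := norm_add_sq_real c (p q - c)
      rw [add_sub_cancel] at h
      rw [dist_eq_norm, hD, h]
      have h' := norm_sub_sq_real (p q) c
      rw [inner_sub_right, real_inner_self_eq_norm_sq, real_inner_comm] at *
      linarith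
    have hstep : ∀ τ ∈ Set.Icc (0 : ℝ) 1, τ * D ≤ τ ^ 2 * N := by
      intro τ hτ
      have hmem : (1 - τ) • w + τ • (Pi.single q 1 : ι → ℝ) ∈ stdSimplex ℝ ι :=
        convex_stdSimplex ℝ ι hw (single_mem_stdSimplex ℝ q) (by linarith [hτ.2]) hτ.1 (by ring)
      have h := hmax hmem
      have e1 : ∑ i, ((1 - τ) • w + τ • (Pi.single q 1 : ι → ℝ)) i * ‖p i‖ ^ 2 =
          (1 - τ) * A + τ * ‖p q‖ ^ 2 := by
        simp [add_mul, Finset.sum_add_distrib, mul_assoc, ← Finset.mul_sum, hA, Pi.single_apply]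
      have e2 : ∑ i, ((1 - τ) • w + τ • (Pi.single q 1 : ι → ℝ)) i • p i = c + τ • (p q - c) := by
        simp only [Pi.add_apply, Pi.smul_apply, smul_eq_mul, add_smul, mul_smul,
          Finset.sum_add_distrib, ← Finset.smul_sum, ← hc, Pi.single_apply, ite_smul, one_smul,
          zero_smul, Finset.sum_ite_eq', Finset.mem_univ, if_true]
        module
      simp only [Set.mem_ofPred_eq, e1, e2, norm_add_sq_real, inner_smul_right, norm_smul,
        mul_pow, Real.norm_eq_abs, sq_abs] at h
      rw [← hc, ← hA] at h
      rw [hD, hN]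
      linarith
    have hD0 : D ≤ 0 := by
      by_contra hpos
      push Not at hpos
      have hN0 : 0 ≤ N := sq_nonneg _
      have hDN0 : 0 < D + N := by linarith
      have h := hstep (D / (D + N)) ⟨by positivity, by rw [div_le_one hDN0]; linarith⟩
      have h1 : D / (D + N) * D * (D + N) ^ 2 ≤ (D / (D + N)) ^ 2 * N * (D + N) ^ 2 :=
        mul_le_mul_of_nonneg_right h (sq_nonneg _)
      have h2 : D / (D + N) * D * (D + N) ^ 2 = D ^ 2 * (D + N) := by field_simp
      have h3 : (D / (D + N)) ^ 2 * N * (D + N) ^ 2 = D ^ 2 * N := by field_simp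
      rw [h2, h3] at h1
      have : 0 < D ^ 2 * D := by positivity
      linarith
    linarith
  refine ⟨w, hw, √(A - ‖c‖ ^ 2), Real.sqrt_nonneg _, fun i => Real.le_sqrt_of_sq_le (key i), ?_⟩
  have hz : ∑ i, w i * (A - ‖c‖ ^ 2 - dist (p i) c ^ 2) = 0 := by
    simp only [mul_sub, Finset.sum_sub_distrib, ← Finset.sum_mul, hw.2]
    linarith
  intro i hi
  have := (Finset.sum_eq_zero_iff_of_nonneg
    (fun i _ => mul_nonneg (hw.1 i) (sub_nonneg.2 (key i)))).1 hz i (Finset.mem_univ i)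
  rcases mul_eq_zero.1 this with h | h
  · exact absurd h hi
  · rw [sub_eq_zero.1 h, Real.sqrt_sq dist_nonneg]

/-- The center of the smallest enclosing ball is a convex combination of points on its boundary. -/
lemma IsSEB.exists_weights {d : ℕ} {S : Finset (Pt d)} (hS : S.Nonempty) {o : Pt d} {R : ℝ}
    (hB : IsSEB (S : Set (Pt d)) o R) :
    ∃ w ∈ stdSimplex ℝ S, ∑ i : S, w i • (i : Pt d) = o ∧
      ∀ i : S, w i ≠ 0 → dist (i : Pt d) o = R := by
  have : Nonempty S := hS.to_subtype
  obtain ⟨w, hw, r, hr0, hr, hwr⟩ := OneCenter.exists_weights (fun i : S => (i : Pt d))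
  have h1 := hB.2 _ r (fun p hp => hr ⟨p, hp⟩)
  have h2 := sq_add_dist_sq_le hw rfl hwr (fun (i : S) _ => hB.1 i.2)
  have hR0 : 0 ≤ R := by
    obtain ⟨s, hs⟩ := hS
    exact dist_nonneg.trans (hB.1 hs)
  have h3 : R ^ 2 ≤ r ^ 2 := pow_le_pow_left₀ hR0 h1 2
  have h4 : dist (∑ i : S, w i • (i : Pt d)) o = 0 := by
    have := sq_nonneg (dist (∑ i : S, w i • (i : Pt d)) o)
    exact pow_eq_zero_iff two_ne_zero |>.1 (by linarith)
  have h5 : r = R := by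
    refine le_antisymm ?_ h1
    rw [h4] at h2
    exact le_of_sq_le_sq (by linarith) hR0
  rw [dist_eq_zero] at h4
  refine ⟨w, hw, h4, fun i hi => ?_⟩
  rw [← h4, ← h5]
  exact hwr i hi

/-- A ball that contains `S` and whose center is a convex combination of points of `S` on its
boundary is the smallest enclosing ball of `S`. -/
lemma IsSEB.eq_of_weights {d : ℕ} {S : Set (Pt d)} {o c : Pt d} {R r : ℝ} (hB : IsSEB S o R)
    {ι : Type*} [Fintype ι] {w : ι → ℝ} {p : ι → Pt d} (hw : w ∈ stdSimplex ℝ ι)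
    (hp : ∀ i, w i ≠ 0 → p i ∈ S) (hc : ∑ i, w i • p i = c)
    (hr : ∀ i, w i ≠ 0 → dist (p i) c = r) (hS : S ⊆ Metric.closedBall c r) : c = o ∧ r = R := by
  have h1 := hB.2 _ _ hS
  have h2 := sq_add_dist_sq_le hw hc hr (fun i hi => hB.1 (hp i hi))
  obtain ⟨i, hi⟩ : ∃ i, w i ≠ 0 := by
    by_contra! hne
    have := hw.2
    simp [hne] at this
  have hR0 : 0 ≤ R := dist_nonneg.trans (hB.1 (hp i hi))
  have h3 : R ^ 2 ≤ r ^ 2 := pow_le_pow_left₀ hR0 h1 2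
  have h4 : dist c o = 0 := by
    have := sq_nonneg (dist c o)
    exact pow_eq_zero_iff two_ne_zero |>.1 (by linarith)
  refine ⟨dist_eq_zero.1 h4, le_antisymm ?_ h1⟩
  rw [h4] at h2
  exact le_of_sq_le_sq (by linarith) hR0

/-! ### Support sets in affine coordinates -/

/-- The point with affine coordinates `w` with respect to the points of `S'`, based at `x`. -/
def basedPoint {d : ℕ} {S' : Finset (Pt d)} (x : Pt d) (w : S' → ℝ) : Pt d :=
  x + ∑ j : S', w j • ((j : Pt d) - x)

/-- The affine coordinates `w` based at a point, completed by the coordinate of the base point. -/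
def fullWeight {ι : Type*} [Fintype ι] (w : ι → ℝ) : Option ι → ℝ :=
  fun i => i.elim (1 - ∑ j, w j) w

lemma sum_fullWeight {ι : Type*} [Fintype ι] (w : ι → ℝ) : ∑ i, fullWeight w i = 1 := by
  simp [fullWeight]

lemma fullWeight_mem {ι : Type*} [Fintype ι] {w : ι → ℝ} (h0 : ∀ j, 0 ≤ w j) (h1 : ∑ j, w j ≤ 1) :
    fullWeight w ∈ stdSimplex ℝ (Option ι) := by
  refine ⟨fun i => ?_, sum_fullWeight w⟩
  cases i with
  | none => simpa [fullWeight] using h1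
  | some j => exact h0 j

lemma sum_fullWeight_smul {d : ℕ} {S' : Finset (Pt d)} (x : Pt d) (w : S' → ℝ) :
    ∑ i : Option S', fullWeight w i • (i.elim x (fun j => (j : Pt d))) = basedPoint x w := by
  simp only [fullWeight, Fintype.sum_option, Option.elim, basedPoint, smul_sub,
    Finset.sum_sub_distrib, ← Finset.sum_smul]
  module

lemma add_sum_smul_sub_mem_convexHull {d : ℕ} {ι : Type*} [Fintype ι] (x : Pt d) {p : ι → Pt d}
    {w : ι → ℝ} (h0 : ∀ j, 0 ≤ w j) (h1 : ∑ j, w j ≤ 1) {V : Set (Pt d)}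
    (hV : ∀ j, w j ≠ 0 → p j ∈ V) :
    x + ∑ j, w j • (p j - x) ∈ convexHull ℝ (insert x V) := by
  classical
  have hw := fullWeight_mem h0 h1
  have h : x + ∑ j, w j • (p j - x) =
      ∑ i, fullWeight w i • (i.elim x (fun j => if w j = 0 then x else p j)) := by
    have : ∀ j, w j • (if w j = 0 then x else p j) = w j • p j := fun j => by
      by_cases hj : w j = 0 <;> simp [hj]
    simp only [fullWeight, Fintype.sum_option, Option.elim, smul_sub, this,
      Finset.sum_sub_distrib, ← Finset.sum_smul]
    module
  rw [h]
  refine (convex_convexHull ℝ _).sum_mem (fun i _ => hw.1 i) hw.2 fun i _ => ?_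
  apply subset_convexHull
  cases i with
  | none => exact Set.mem_insert _ _
  | some j =>
    by_cases hj : w j = 0
    · simp [hj]
    · simpa [hj] using Or.inr (hV j hj)

lemma exists_basedPoint_of_mem_convexHull {d : ℕ} {S' : Finset (Pt d)} {x c : Pt d}
    (h : c ∈ convexHull ℝ (insert x (S' : Set (Pt d)))) :
    ∃ w : S' → ℝ, (∀ j, 0 ≤ w j) ∧ ∑ j, w j ≤ 1 ∧ c = basedPoint x w := by
  classical
  let K : Set (Pt d) := {c | ∃ w : S' → ℝ, (∀ j, 0 ≤ w j) ∧ ∑ j, w j ≤ 1 ∧ c = basedPoint x w}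
  suffices hK : convexHull ℝ (insert x (S' : Set (Pt d))) ⊆ K from hK h
  refine convexHull_min ?_ ?_
  · rintro y (rfl | hy)
    · exact ⟨0, fun _ => le_rfl, by simp, by simp [basedPoint]⟩
    · refine ⟨Pi.single ⟨y, hy⟩ 1, fun j => ?_, by simp, ?_⟩
      · by_cases hj : j = ⟨y, hy⟩
        · subst hj; simp
        · simp [hj]
      · simp [basedPoint, Pi.single_apply, ite_smul]
  · rintro _ ⟨w, hw0, hw1, rfl⟩ _ ⟨w', hw0', hw1', rfl⟩ a b ha hb hab
    refine ⟨fun j => a * w j + b * w' j, fun j => add_nonneg (mul_nonneg ha (hw0 j))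
      (mul_nonneg hb (hw0' j)), ?_, ?_⟩
    · rw [Finset.sum_add_distrib, ← Finset.mul_sum, ← Finset.mul_sum]
      nlinarith
    · simp only [basedPoint, add_smul, mul_smul, Finset.sum_add_distrib, ← Finset.smul_sum]
      obtain rfl : b = 1 - a := by linarith
      module

lemma affineIndependent_insert_iff {d : ℕ} {S' : Finset (Pt d)} {x : Pt d} (hx : x ∉ S') :
    AffineIndependent ℝ (fun y : (insert x (S' : Set (Pt d)) : Set (Pt d)) => (y : Pt d)) ↔
      LinearIndependent ℝ (fun j : S' => (j : Pt d) - x) := by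
  rw [affineIndependent_iff_linearIndependent_vsub ℝ _
    (⟨x, Set.mem_insert _ _⟩ : (insert x (S' : Set (Pt d)) : Set (Pt d)))]
  let e : S' ≃ {y : (insert x (S' : Set (Pt d)) : Set (Pt d)) // y ≠ ⟨x, Set.mem_insert _ _⟩} :=
    { toFun := fun j => ⟨⟨j, Set.mem_insert_of_mem _ j.2⟩, fun h => hx (by
        have := congrArg Subtype.val h
        simp only at this
        rw [← this]; exact j.2)⟩
      invFun := fun y => ⟨y.1.1, by
        rcases y.1.2 with h | h
        · exact absurd (Subtype.ext h) y.2
        · exact h⟩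
      left_inv := fun _ => rfl
      right_inv := fun _ => rfl }
  exact (linearIndependent_equiv e).symm

/-- If the vectors `s - x`, `s ∈ S'`, are linearly independent, then `x ∉ S'`, as `0` is not among
them. -/
lemma notMem_of_linearIndependent {d : ℕ} {S' : Finset (Pt d)} {x : Pt d}
    (h : LinearIndependent ℝ (fun j : S' => (j : Pt d) - x)) : x ∉ S' := by
  intro hx
  exact h.ne_zero ⟨x, hx⟩ (by simp)

/-- The test for support sets in terms of affine coordinates: the sphere around the center passes
through `x` and `S'` and encloses `S`, and the coordinates of the center are nonnegative. -/
lemma isSupport_iff {d : ℕ} {S S' : Finset (Pt d)} {x : Pt d} :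
    IsSupport S S' x ↔ S' ⊆ S ∧ S'.Nonempty ∧
      LinearIndependent ℝ (fun j : S' => (j : Pt d) - x) ∧
      ∃ w : S' → ℝ, (∀ j, 0 ≤ w j) ∧ ∑ j, w j ≤ 1 ∧
        (∀ s ∈ S', dist s (basedPoint x w) = dist x (basedPoint x w)) ∧
        ∀ l ∈ S, dist l (basedPoint x w) ≤ dist x (basedPoint x w) := by
  constructor
  · rintro ⟨h1, h2, h3, h4, c, r, h5, h6, h7⟩
    obtain ⟨w, hw0, hw1, rfl⟩ := exists_basedPoint_of_mem_convexHull h7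
    have hx : dist x (basedPoint x w) = r := h5.1 (Set.mem_insert _ _)
    refine ⟨h1, h2, (affineIndependent_insert_iff h3).1 h4, w, hw0, hw1, fun s hs => ?_,
      fun l hl => ?_⟩
    · rw [hx]; exact h5.1 (Set.mem_insert_of_mem _ hs)
    · rw [hx]; exact h6 hl
  · rintro ⟨h1, h2, h3, w, hw0, hw1, h4, h5⟩
    have hx := notMem_of_linearIndependent h3
    refine ⟨h1, h2, hx, (affineIndependent_insert_iff hx).2 h3, basedPoint x w,
      dist x (basedPoint x w), ⟨?_, ?_⟩, fun l hl => h5 l hl,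
      add_sum_smul_sub_mem_convexHull x hw0 hw1 fun j _ => j.2⟩
    · rintro y (rfl | hy)
      · exact rfl
      · exact h4 y hy
    · intro c' r' h'
      have hr' : dist x c' = r' := h' (Set.mem_insert _ _)
      have := sq_add_dist_sq_le (r := dist x (basedPoint x w)) (c' := c') (r' := r')
        (fullWeight_mem hw0 hw1) (sum_fullWeight_smul x w)
        (fun i _ => by cases i with
          | none => rfl
          | some j => exact h4 j j.2)
        (fun i _ => by cases i with
          | none => exact hr'.le
          | some j => exact (h' (Set.mem_insert_of_mem _ j.2)).le)
      exact le_of_sq_le_sq (by nlinarith [sq_nonneg (dist (basedPoint x w) c')])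
        (hr' ▸ dist_nonneg)

/-- A ball around a convex combination of `x` and points of `S`, all of them on its boundary, is
the smallest enclosing ball of `S ∪ {x}` if it contains `S`. -/
lemma isSEB_insert {d : ℕ} {S S' : Finset (Pt d)} {x : Pt d} (hS' : S' ⊆ S) {w : S' → ℝ}
    (h0 : ∀ j, 0 ≤ w j) (h1 : ∑ j, w j ≤ 1)
    (h2 : ∀ s ∈ S', dist s (basedPoint x w) = dist x (basedPoint x w))
    (h3 : ∀ l ∈ S, dist l (basedPoint x w) ≤ dist x (basedPoint x w)) :
    IsSEB (insert x (S : Set (Pt d))) (basedPoint x w) (dist x (basedPoint x w)) := by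
  constructor
  · rintro y (rfl | hy)
    · exact le_refl (dist y _)
    · exact h3 y hy
  · intro c' r' h'
    have := sq_add_dist_sq_le (r := dist x (basedPoint x w)) (c' := c') (r' := r')
      (fullWeight_mem h0 h1) (sum_fullWeight_smul x w)
      (fun i _ => by cases i with
        | none => rfl
        | some j => exact h2 j j.2)
      (fun i _ => by cases i with
        | none => exact h' (Set.mem_insert _ _)
        | some j => exact h' (Set.mem_insert_of_mem _ (hS' j.2)))
    exact le_of_sq_le_sq (by nlinarith [sq_nonneg (dist (basedPoint x w) c')])
      (dist_nonneg.trans (h' (Set.mem_insert _ _)))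

/-! ### Existence of support sets -/

/-- If `c` is a convex combination of `x` and `S`, then `S` can be thinned out to a set `S'` with
the same property for which the vectors `s - x` are linearly independent: Carathéodory's theorem
with the vertex `x` retained. -/
lemma exists_linearIndependent_basedPoint {d : ℕ} (S : Finset (Pt d)) {x c : Pt d}
    (hc : c ∈ convexHull ℝ (insert x (S : Set (Pt d)))) :
    ∃ S' ⊆ S, LinearIndependent ℝ (fun j : S' => (j : Pt d) - x) ∧
      ∃ w : S' → ℝ, (∀ j, 0 ≤ w j) ∧ ∑ j, w j ≤ 1 ∧ c = basedPoint x w := by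
  classical
  obtain ⟨S', hS', hmin⟩ := Finset.exists_min_image
    (S.powerset.filter fun S' : Finset (Pt d) => c ∈ convexHull ℝ (insert x (S' : Set (Pt d))))
    Finset.card
    ⟨S, by simpa using hc⟩
  rw [Finset.mem_filter, Finset.mem_powerset] at hS'
  obtain ⟨w, hw0, hw1, hw⟩ := exists_basedPoint_of_mem_convexHull hS'.2
  refine ⟨S', hS'.1, ?_, w, hw0, hw1, hw⟩
  by_contra hdep
  obtain ⟨g, hg, hgs, i, hi⟩ : ∃ g : S' → ℝ, ∑ j, g j • ((j : Pt d) - x) = 0 ∧ 0 ≤ ∑ j, g j ∧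
      ∃ i, g i ≠ 0 := by
    obtain ⟨g, hg, i, hi⟩ := Fintype.not_linearIndependent_iff.1 hdep
    rcases le_total 0 (∑ j, g j) with h | h
    · exact ⟨g, hg, h, i, hi⟩
    · exact ⟨-g, by simpa using hg, by simpa using h, i, by simpa using hi⟩
  obtain ⟨i, hi⟩ : ∃ i, 0 < g i := by
    by_contra! hneg
    have h0 := (Finset.sum_eq_zero_iff_of_nonpos fun j _ => hneg j).1
      (le_antisymm (Finset.sum_nonpos fun j _ => hneg j) hgs)
    exact hi (h0 i (Finset.mem_univ i))
  -- move along the dependence until the first weight vanishes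
  obtain ⟨j₀, hj₀, hj⟩ := Finset.exists_min_image (Finset.univ.filter fun j => 0 < g j)
    (fun j => w j / g j) ⟨i, by simpa using hi⟩
  rw [Finset.mem_filter] at hj₀
  set τ := w j₀ / g j₀ with hτ
  have hτ0 : 0 ≤ τ := div_nonneg (hw0 _) hj₀.2.le
  have hz : w j₀ - τ * g j₀ = 0 := by
    rw [hτ, div_mul_cancel₀ _ hj₀.2.ne', sub_self]
  have hmem : c ∈ convexHull ℝ (insert x ((S'.erase j₀ : Finset (Pt d)) : Set (Pt d))) := by
    have h : c = x + ∑ j : S', (w j - τ * g j) • ((j : Pt d) - x) := by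
      simp only [sub_smul, mul_smul, Finset.sum_sub_distrib, ← Finset.smul_sum, hg, smul_zero,
        sub_zero]
      exact hw
    rw [h]
    refine add_sum_smul_sub_mem_convexHull x (fun j => ?_) ?_ fun j hj' => ?_
    · by_cases hgj : 0 < g j
      · have := hj j (by simpa using hgj)
        rw [le_div_iff₀ hgj] at this
        linarith
      · have := mul_nonneg hτ0 (neg_nonneg.2 (not_lt.1 hgj))
        linarith [hw0 j]
    · rw [Finset.sum_sub_distrib, ← Finset.mul_sum]
      linarith [mul_nonneg hτ0 hgs]
    · rw [Finset.mem_coe, Finset.mem_erase]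
      refine ⟨fun h => ?_, j.2⟩
      rw [Subtype.ext h] at hj'
      exact hj' hz
  have := hmin (S'.erase j₀) (by
    rw [Finset.mem_filter, Finset.mem_powerset]
    exact ⟨(Finset.erase_subset _ _).trans hS'.1, hmem⟩)
  exact absurd this (not_le.2 (Finset.card_erase_lt_of_mem j₀.2))

/-- A mobile point that is not in the interior of the smallest enclosing ball of the static points
has a support set. -/
lemma exists_isSupport {d : ℕ} {S : Finset (Pt d)} (hcard : 2 ≤ S.card) {o : Pt d} {R : ℝ}
    (hB : IsSEB (S : Set (Pt d)) o R) {x : Pt d} (hx : x ∉ Metric.ball o R) :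
    ∃ S', IsSupport S S' x := by
  classical
  let U : Finset (Pt d) := insert x S
  have : Nonempty U := ⟨⟨x, Finset.mem_insert_self _ _⟩⟩
  obtain ⟨w, hw, r, hr0, hr, hwr⟩ := exists_weights (fun i : U => (i : Pt d))
  set c := ∑ i : U, w i • (i : Pt d) with hc
  -- if `x` were in the interior, its weight would vanish, and the ball would be the one of `S`
  have hxr : dist x c = r := by
    by_contra hne
    have hwx : ∀ i : U, w i ≠ 0 → (i : Pt d) ∈ (S : Set (Pt d)) := by
      intro i hi
      rcases Finset.mem_insert.1 i.2 with h | h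
      · exact absurd (h ▸ hwr i hi) hne
      · exact h
    obtain ⟨h1, h2⟩ := hB.eq_of_weights hw hwx hc.symm hwr
      (fun s hs => hr ⟨s, Finset.mem_insert_of_mem hs⟩)
    apply hx
    rw [Metric.mem_ball, ← h1, ← h2]
    exact lt_of_le_of_ne (hr ⟨x, Finset.mem_insert_self _ _⟩) hne
  have hmem : c ∈ convexHull ℝ
      (insert x ((S.filter fun s => dist s c = r : Finset (Pt d)) : Set (Pt d))) := by
    have hcx : c = x + ∑ i : U, (if (i : Pt d) = x then 0 else w i) • ((i : Pt d) - x) := by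
      have : ∀ i : U, (if (i : Pt d) = x then 0 else w i) • ((i : Pt d) - x) =
          w i • ((i : Pt d) - x) := fun i => by
        by_cases hi : (i : Pt d) = x <;> simp [hi]
      simp only [this, smul_sub, Finset.sum_sub_distrib, ← Finset.sum_smul, hw.2, ← hc]
      module
    rw [hcx]
    refine add_sum_smul_sub_mem_convexHull x (fun i => ?_) ?_ fun i hi => ?_
    · split_ifs
      · exact le_rfl
      · exact hw.1 i
    · rw [← hw.2]
      refine Finset.sum_le_sum fun i _ => ?_
      split_ifs
      · exact hw.1 i
      · exact le_rfl
    · rw [← hcx]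
      by_cases hix : (i : Pt d) = x
      · simp [hix] at hi
      · rw [if_neg hix] at hi
        simpa using ⟨(Finset.mem_insert.1 i.2).resolve_left hix, hwr i hi⟩
  obtain ⟨S', hS', hli, w', hw0, hw1, hcw⟩ := exists_linearIndependent_basedPoint _ hmem
  have hS : ∀ l ∈ S, dist l c ≤ dist x c := fun l hl =>
    hxr ▸ hr ⟨l, Finset.mem_insert_of_mem hl⟩
  refine ⟨S', isSupport_iff.2 ⟨hS'.trans (Finset.filter_subset _ _), ?_, hli, w', hw0, hw1, ?_, ?_⟩⟩
  · rw [Finset.nonempty_iff_ne_empty]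
    rintro rfl
    have hcx : c = x := by simpa [basedPoint] using hcw
    obtain ⟨a, ha, b, hb, hab⟩ := Finset.one_lt_card.1 hcard
    have h1 := hS a ha
    have h2 := hS b hb
    rw [hcx, dist_self, dist_le_zero] at h1 h2
    exact hab (h1.trans h2.symm)
  · intro s hs
    rw [← hcw, hxr]
    exact (Finset.mem_filter.1 (hS' hs)).2
  · rwa [← hcw]

lemma IsSupport.notMem_ball {d : ℕ} {S S' : Finset (Pt d)} {o : Pt d} {R : ℝ}
    (hB : IsSEB (S : Set (Pt d)) o R) {x : Pt d} (h : IsSupport S S' x) :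
    x ∉ Metric.ball o R := by
  intro hx
  obtain ⟨h1, ⟨s, hs⟩, -, w, hw0, hw1, h4, h5⟩ := isSupport_iff.1 h
  set c := basedPoint x w with hc
  have h6 := hB.2 c (dist x c) h5
  have h7 : dist x c ^ 2 + dist c o ^ 2 ≤ R ^ 2 :=
    sq_add_dist_sq_le (fullWeight_mem hw0 hw1) (sum_fullWeight_smul x w)
      (fun i _ => by cases i with
        | none => rfl
        | some j => exact h4 j j.2)
      (fun i _ => by cases i with
        | none => exact (Metric.mem_ball.1 hx).le
        | some j => exact hB.1 (h1 j.2))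
  have hR0 : 0 ≤ R := dist_nonneg.trans (hB.1 (h1 hs))
  have h8 : R ^ 2 ≤ dist x c ^ 2 := pow_le_pow_left₀ hR0 h6 2
  have h9 : dist c o = 0 := by
    have := sq_nonneg (dist c o)
    exact pow_eq_zero_iff two_ne_zero |>.1 (by linarith)
  rw [dist_eq_zero] at h9
  rw [h9] at h6
  exact absurd (Metric.mem_ball.1 hx) (not_lt.2 h6)

lemma isSEB_insert_of_mem {d : ℕ} {S : Set (Pt d)} {o x : Pt d} {R : ℝ} (hB : IsSEB S o R)
    (hx : x ∈ Metric.closedBall o R) : IsSEB (insert x S) o R :=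
  ⟨Set.insert_subset hx hB.1, fun c r h => hB.2 c r ((Set.subset_insert _ _).trans h)⟩

/-- Let `o` be a convex combination of the points of `S'`, all of them at distance `R` from `o`.
For a sphere through `x` and `S'` with center `ξ`, the affine coordinate of `ξ` at `x` has the sign
of the power of `x` with respect to the ball around `o`. -/
lemma one_sub_sum_mul_power {d : ℕ} {S' : Finset (Pt d)} {o x : Pt d} {R : ℝ} {μ w : S' → ℝ}
    (hμ : ∑ j, μ j = 1) (ho : ∑ j, μ j • (j : Pt d) = o) (hR : ∀ j : S', dist (j : Pt d) o = R)
    (hw : ∀ s ∈ S', dist s (basedPoint x w) = dist x (basedPoint x w)) :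
    (1 - ∑ j, w j) * (dist x o ^ 2 - R ^ 2) = 2 * dist (basedPoint x w) o ^ 2 := by
  set c := basedPoint x w with hc
  have h1 := sum_mul_dist_sq μ (fun j : S' => (j : Pt d)) hμ o ho c
  have h2 := sum_mul_dist_sq (fullWeight w)
    (fun i : Option S' => i.elim x (fun j => (j : Pt d))) (sum_fullWeight w) c
    (sum_fullWeight_smul x w) o
  have h3 : ∀ j : S', dist (j : Pt d) c = dist x c := fun j => hw j j.2
  simp only [hR, h3, ← Finset.sum_mul, hμ, fullWeight, Fintype.sum_option, Option.elim] at h1 h2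
  rw [dist_comm o c] at h1
  linarith

/-! ### Values of rational functions -/

/-- The rational functions without a pole at `t`. -/
def regularSubring (t : ℝ) : Subring (RatFunc ℝ) where
  carrier := {f | f.denom.eval t ≠ 0}
  mul_mem' := fun {f g} hf hg h => by
    have := Polynomial.eval_dvd (x := t) (RatFunc.denom_mul_dvd f g)
    rw [h, zero_dvd_iff, Polynomial.eval_mul] at this
    exact (mul_ne_zero hf hg) this
  one_mem' := by simp
  add_mem' := fun {f g} hf hg h => by
    have := Polynomial.eval_dvd (x := t) (RatFunc.denom_add_dvd f g)
    rw [h, zero_dvd_iff, Polynomial.eval_mul] at this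
    exact (mul_ne_zero hf hg) this
  zero_mem' := by simp
  neg_mem' := fun {f} hf => by
    have h2 : -f = RatFunc.C (-1) * f := by simp
    have := RatFunc.denom_mul_dvd (RatFunc.C (-1)) f
    rw [← h2, RatFunc.denom_C, one_mul] at this
    intro h
    have := Polynomial.eval_dvd (x := t) this
    rw [h, zero_dvd_iff] at this
    exact hf this

lemma mem_regularSubring {t : ℝ} {f : RatFunc ℝ} :
    f ∈ regularSubring t ↔ f.denom.eval t ≠ 0 := Iff.rfl

/-- The value of a rational function at `t`, which is `0` by convention at a pole. -/
abbrev val (t : ℝ) (f : RatFunc ℝ) : ℝ := f.eval (RingHom.id ℝ) t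

lemma val_def (t : ℝ) (f : RatFunc ℝ) : val t f = f.num.eval t / f.denom.eval t := by
  simp [val, RatFunc.eval, Polynomial.eval₂_id]

/-- The evaluation of the rational functions without a pole at `t`. -/
def valHom (t : ℝ) : regularSubring t →+* ℝ where
  toFun f := val t f
  map_one' := by simp
  map_zero' := by simp
  map_add' f g := RatFunc.eval_add _ _ (by rw [Polynomial.eval₂_id]; exact f.2)
    (by rw [Polynomial.eval₂_id]; exact g.2)
  map_mul' f g := RatFunc.eval_mul _ _ (by rw [Polynomial.eval₂_id]; exact f.2)
    (by rw [Polynomial.eval₂_id]; exact g.2)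

lemma C_mem_regularSubring (t a : ℝ) : RatFunc.C a ∈ regularSubring t := by
  simp [mem_regularSubring]

lemma val_C (t a : ℝ) : val t (RatFunc.C a) = a := by simp [val]

lemma val_add {t : ℝ} {f g : RatFunc ℝ} (hf : f ∈ regularSubring t) (hg : g ∈ regularSubring t) :
    val t (f + g) = val t f + val t g := (valHom t).map_add ⟨f, hf⟩ ⟨g, hg⟩

lemma val_sub {t : ℝ} {f g : RatFunc ℝ} (hf : f ∈ regularSubring t) (hg : g ∈ regularSubring t) :
    val t (f - g) = val t f - val t g := (valHom t).map_sub ⟨f, hf⟩ ⟨g, hg⟩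

lemma val_mul {t : ℝ} {f g : RatFunc ℝ} (hf : f ∈ regularSubring t) (hg : g ∈ regularSubring t) :
    val t (f * g) = val t f * val t g := (valHom t).map_mul ⟨f, hf⟩ ⟨g, hg⟩

lemma val_sum {ι : Type*} {s : Finset ι} {t : ℝ} {f : ι → RatFunc ℝ}
    (hf : ∀ i ∈ s, f i ∈ regularSubring t) : val t (∑ i ∈ s, f i) = ∑ i ∈ s, val t (f i) := by
  classical
  induction s using Finset.induction_on with
  | empty => simp
  | insert a s ha ih =>
    rw [Finset.sum_insert ha, Finset.sum_insert ha, val_add, ih]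
    · exact fun i hi => hf i (Finset.mem_insert_of_mem hi)
    · exact hf a (Finset.mem_insert_self _ _)
    · exact Subring.sum_mem _ fun i hi => hf i (Finset.mem_insert_of_mem hi)

lemma det_mem_regularSubring {n : Type*} [Fintype n] [DecidableEq n] {t : ℝ}
    {M : Matrix n n (RatFunc ℝ)} (hM : ∀ i j, M i j ∈ regularSubring t) :
    M.det ∈ regularSubring t ∧ val t M.det = (Matrix.of fun i j => val t (M i j)).det := by
  let M' : Matrix n n (regularSubring t) := Matrix.of fun i j => ⟨M i j, hM i j⟩
  have h1 : M.det = ((M'.det : regularSubring t) : RatFunc ℝ) :=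
    ((regularSubring t).subtype.map_det M').symm
  refine ⟨h1 ▸ M'.det.2, ?_⟩
  rw [h1]
  exact (valHom t).map_det M'

lemma div_mem_regularSubring {t : ℝ} {f g : RatFunc ℝ} (hf : f ∈ regularSubring t)
    (hg : val t g ≠ 0) : f / g ∈ regularSubring t := by
  rw [div_eq_mul_inv]
  refine mul_mem hf fun h => ?_
  have hg0 : g ≠ 0 := fun h0 => hg (by simp [h0])
  have := Polynomial.eval_dvd (x := t) (RatFunc.denom_inv_dvd hg0)
  rw [h, zero_dvd_iff] at this
  rw [val_def, this, zero_div] at hg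
  exact hg rfl

lemma eventually_polynomial_eval_ne_zero {p : Polynomial ℝ} (hp : p ≠ 0) (t₀ : ℝ) :
    ∀ᶠ t in 𝓝[≠] t₀, p.eval t ≠ 0 := by
  have hfin : ({t | p.IsRoot t} \ {t₀} : Set ℝ).Finite :=
    (Polynomial.finite_setOfPred_isRoot hp).subset Set.sdiff_subset
  have := hfin.isClosed.isOpen_compl.mem_nhds (x := t₀) (by simp)
  filter_upwards [mem_nhdsWithin_of_mem_nhds this, self_mem_nhdsWithin] with t ht ht' h
  exact ht ⟨h, ht'⟩

lemma eventually_mem_regularSubring (f : RatFunc ℝ) (t₀ : ℝ) :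
    ∀ᶠ t in 𝓝[≠] t₀, f ∈ regularSubring t :=
  eventually_polynomial_eval_ne_zero f.denom_ne_zero t₀

lemma eventually_val_ne_zero {f : RatFunc ℝ} (hf : f ≠ 0) (t₀ : ℝ) :
    ∀ᶠ t in 𝓝[≠] t₀, val t f ≠ 0 := by
  filter_upwards [eventually_mem_regularSubring f t₀,
    eventually_polynomial_eval_ne_zero (RatFunc.num_ne_zero hf) t₀] with t h1 h2
  rw [val_def]
  exact div_ne_zero h2 h1

lemma meromorphicAt_val (f : RatFunc ℝ) (t₀ : ℝ) : MeromorphicAt (fun t => val t f) t₀ := by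
  simp only [val_def]
  have h : ∀ p : Polynomial ℝ, MeromorphicAt (fun t => p.eval t) t₀ := fun p =>
    (AnalyticOnNhd.eval_polynomial p t₀ (Set.mem_univ _)).meromorphicAt
  exact (h _).div (h _)

lemma continuousAt_val {f : RatFunc ℝ} {t₀ : ℝ} (hf : f ∈ regularSubring t₀) :
    ContinuousAt (fun t => val t f) t₀ := by
  simp only [val_def]
  exact f.num.continuous.continuousAt.div f.denom.continuous.continuousAt hf

/-- A rational function that is bounded on one side of `t₀` has no pole there. -/
lemma mem_regularSubring_of_bounded {f : RatFunc ℝ} {t₀ b : ℝ} {F : Filter ℝ} [F.NeBot]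
    (hF : F ≤ 𝓝[≠] t₀) (hb : ∀ᶠ t in F, |val t f| ≤ b) : f ∈ regularSubring t₀ := by
  intro h0
  have hF' : F ≤ 𝓝 t₀ := hF.trans nhdsWithin_le_nhds
  have hden : Tendsto (fun t => f.denom.eval t) F (𝓝 0) := by
    rw [← h0]
    exact f.denom.continuous.continuousAt.tendsto.mono_left hF'
  have hnum : Tendsto (fun t => f.num.eval t) F (𝓝 0) := by
    have hlim : Tendsto (fun t => b * |f.denom.eval t|) F (𝓝 0) := by
      simpa using (hden.abs.const_mul b)
    refine squeeze_zero_norm' ?_ hlim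
    filter_upwards [hb, hF (eventually_mem_regularSubring f t₀)] with t h1 h2
    rw [val_def, abs_div, div_le_iff₀ (abs_pos.2 h2)] at h1
    exact h1
  have hnum0 : f.num.eval t₀ = 0 :=
    tendsto_nhds_unique (f.num.continuous.continuousAt.tendsto.mono_left hF') hnum
  obtain ⟨a, c, hac⟩ := f.isCoprime_num_denom
  have := congrArg (Polynomial.eval t₀) hac
  simp [hnum0, h0] at this

/-! ### One-sided behaviour of meromorphic functions -/

/-- `F` is one of the two filters of one-sided neighbourhoods of `t₀`. -/
def IsSide (t₀ : ℝ) (F : Filter ℝ) : Prop := F = 𝓝[<] t₀ ∨ F = 𝓝[>] t₀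

lemma isSide_left (t₀ : ℝ) : IsSide t₀ (𝓝[<] t₀) := Or.inl rfl

lemma isSide_right (t₀ : ℝ) : IsSide t₀ (𝓝[>] t₀) := Or.inr rfl

lemma IsSide.le {t₀ : ℝ} {F : Filter ℝ} (h : IsSide t₀ F) : F ≤ 𝓝[≠] t₀ := by
  rcases h with rfl | rfl
  · exact nhdsWithin_mono _ fun t ht => (Set.mem_Iio.1 ht).ne
  · exact nhdsWithin_mono _ fun t ht => (Set.mem_Ioi.1 ht).ne'

lemma IsSide.neBot {t₀ : ℝ} {F : Filter ℝ} (h : IsSide t₀ F) : F.NeBot := by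
  rcases h with rfl | rfl <;> infer_instance

lemma IsSide.exists_isPreconnected {t₀ : ℝ} {F : Filter ℝ} (h : IsSide t₀ F) {A : Set ℝ}
    (hA : A ∈ F) : ∃ B ∈ F, B ⊆ A ∧ IsPreconnected B := by
  rcases h with rfl | rfl
  · obtain ⟨u, hu, huA⟩ := mem_nhdsLT_iff_exists_Ioo_subset.1 hA
    exact ⟨Set.Ioo u t₀, Ioo_mem_nhdsLT hu, huA, isPreconnected_Ioo⟩
  · obtain ⟨u, hu, huA⟩ := mem_nhdsGT_iff_exists_Ioo_subset.1 hA
    exact ⟨Set.Ioo t₀ u, Ioo_mem_nhdsGT hu, huA, isPreconnected_Ioo⟩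

/-- The filter `F` decides the predicate `p`. For one-sided neighbourhoods this is the tameness
that makes semialgebraic conditions on rational curves eventually true or eventually false. -/
def Decides (F : Filter ℝ) (p : ℝ → Prop) : Prop := (∀ᶠ t in F, p t) ∨ ∀ᶠ t in F, ¬ p t

lemma Decides.not {F : Filter ℝ} {p : ℝ → Prop} (h : Decides F p) : Decides F fun t => ¬ p t := by
  rcases h with h | h
  · exact Or.inr (h.mono fun t ht => not_not.2 ht)
  · exact Or.inl h

lemma Decides.and {F : Filter ℝ} {p q : ℝ → Prop} (hp : Decides F p) (hq : Decides F q) :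
    Decides F fun t => p t ∧ q t := by
  rcases hp with hp | hp
  · rcases hq with hq | hq
    · exact Or.inl (hp.and hq)
    · exact Or.inr (hq.mono fun t ht h => ht h.2)
  · exact Or.inr (hp.mono fun t ht h => ht h.1)

lemma Decides.congr {F : Filter ℝ} {p q : ℝ → Prop} (hp : Decides F p)
    (h : ∀ᶠ t in F, p t ↔ q t) : Decides F q := by
  rcases hp with hp | hp
  · exact Or.inl (by filter_upwards [hp, h] with t h1 h2 using h2.1 h1)
  · exact Or.inr (by filter_upwards [hp, h] with t h1 h2 h3 using h1 (h2.2 h3))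

lemma Decides.const (F : Filter ℝ) (p : Prop) : Decides F fun _ => p := by
  by_cases h : p
  · exact Or.inl (Eventually.of_forall fun _ => h)
  · exact Or.inr (Eventually.of_forall fun _ => h)

lemma Decides.forall_finite {F : Filter ℝ} {ι : Type*} [Finite ι] {p : ι → ℝ → Prop}
    (h : ∀ i, Decides F (p i)) : Decides F fun t => ∀ i, p i t := by
  by_cases hall : ∀ i, ∀ᶠ t in F, p i t
  · exact Or.inl (eventually_all.2 hall)
  · push Not at hall
    obtain ⟨i, hi⟩ := hall
    exact Or.inr (((h i).resolve_left fun h => hi (h.mono fun _ => not_not.2)).mono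
      fun t ht h' => ht (h' i))

lemma Decides.forall_finset {F : Filter ℝ} {ι : Type*} {s : Finset ι} {p : ι → ℝ → Prop}
    (h : ∀ i ∈ s, Decides F (p i)) : Decides F fun t => ∀ i ∈ s, p i t :=
  (Decides.forall_finite (ι := s) fun i => h i i.2).congr
    (Eventually.of_forall fun _ => ⟨fun h i hi => h ⟨i, hi⟩, fun h i => h i i.2⟩)

lemma decides_nonneg {t₀ : ℝ} {F : Filter ℝ} (hF : IsSide t₀ F) {f : ℝ → ℝ}
    (hf : MeromorphicAt f t₀) : Decides F fun t => 0 ≤ f t := by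
  have := hF.neBot
  rcases hf.eventually_eq_zero_or_eventually_ne_zero with h | h
  · exact Or.inl (by filter_upwards [hF.le h] with t ht using ht.ge)
  · obtain ⟨B, hB, hBA, hBc⟩ := hF.exists_isPreconnected (hF.le (h.and hf.eventually_continuousAt))
    by_cases hpos : ∃ b ∈ B, 0 ≤ f b
    · obtain ⟨b, hb, hb0⟩ := hpos
      refine Or.inl (mem_of_superset hB fun a ha => ?_)
      by_contra hneg
      obtain ⟨c, hc, hc0⟩ := hBc.intermediate_value ha hb
        (fun x hx => (hBA hx).2.continuousWithinAt) ⟨(not_le.1 hneg).le, hb0⟩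
      exact (hBA hc).1 hc0
    · push Not at hpos
      exact Or.inr (mem_of_superset hB fun a ha => not_le.2 (hpos a ha))

lemma decides_le {t₀ : ℝ} {F : Filter ℝ} (hF : IsSide t₀ F) {f g : ℝ → ℝ}
    (hf : MeromorphicAt f t₀) (hg : MeromorphicAt g t₀) : Decides F fun t => f t ≤ g t :=
  (decides_nonneg hF (hg.sub hf)).congr (Eventually.of_forall fun _ => sub_nonneg)

/-! ### Points of rational curves -/

lemma RatCurve.eventually_definedAt {d : ℕ} (γ : RatCurve d) (t₀ : ℝ) :
    ∀ᶠ t in 𝓝[≠] t₀, γ.DefinedAt t :=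
  eventually_all.2 fun i => eventually_mem_regularSubring (γ i) t₀

lemma RatCurve.point_apply {d : ℕ} (γ : RatCurve d) (t : ℝ) (i : Fin d) :
    γ.point t i = val t (γ i) := rfl

lemma RatCurve.continuousAt_point {d : ℕ} {γ : RatCurve d} {t₀ : ℝ} (h : γ.DefinedAt t₀) :
    ContinuousAt γ.point t₀ :=
  (PiLp.continuous_toLp 2 _).continuousAt.comp
    (continuousAt_pi.2 fun i => continuousAt_val (h i))

lemma RatCurve.const_point {d : ℕ} (c : Pt d) (t : ℝ) : (RatCurve.const c).point t = c := by
  ext i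
  exact val_C t (c i)

lemma RatCurve.const_definedAt {d : ℕ} (c : Pt d) (t : ℝ) : (RatCurve.const c).DefinedAt t :=
  fun i => C_mem_regularSubring t (c i)

lemma meromorphicAt_dist_sq {d : ℕ} (γ δ : RatCurve d) (t₀ : ℝ) :
    MeromorphicAt (fun t => dist (γ.point t) (δ.point t) ^ 2) t₀ := by
  have h : (fun t => dist (γ.point t) (δ.point t) ^ 2) =
      fun t => ∑ i, (val t (γ i) - val t (δ i)) ^ 2 := by
    funext t
    rw [EuclideanSpace.dist_eq, Real.sq_sqrt (Finset.sum_nonneg fun _ _ => sq_nonneg _)]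
    simp [Real.dist_eq, sq_abs, RatCurve.point_apply]
  rw [h]
  exact MeromorphicAt.fun_sum fun i _ =>
    ((meromorphicAt_val (γ i) t₀).sub (meromorphicAt_val (δ i) t₀)).pow 2

lemma meromorphicAt_dist_sq_left {d : ℕ} (γ : RatCurve d) (c : Pt d) (t₀ : ℝ) :
    MeromorphicAt (fun t => dist c (γ.point t) ^ 2) t₀ := by
  simpa only [RatCurve.const_point] using meromorphicAt_dist_sq (RatCurve.const c) γ t₀

lemma decides_dist_le {d : ℕ} (γ δ γ' δ' : RatCurve d) {t₀ : ℝ} {F : Filter ℝ}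
    (hF : IsSide t₀ F) :
    Decides F fun t => dist (γ.point t) (δ.point t) ≤ dist (γ'.point t) (δ'.point t) :=
  (decides_le hF (meromorphicAt_dist_sq γ δ t₀) (meromorphicAt_dist_sq γ' δ' t₀)).congr
    (Eventually.of_forall fun _ => pow_le_pow_iff_left₀ dist_nonneg dist_nonneg two_ne_zero)

/-! ### The circumcenter curve -/

lemma gram_mem_regularSubring {d : ℕ} {S' : Finset (Pt d)} {ν : RatCurve d} {t : ℝ}
    (hν : ν.DefinedAt t) (i j : S') : gram S' ν i j ∈ regularSubring t :=
  Subring.sum_mem _ fun k _ => mul_mem (sub_mem (C_mem_regularSubring t _) (hν k))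
    (sub_mem (C_mem_regularSubring t _) (hν k))

lemma val_gram {d : ℕ} {S' : Finset (Pt d)} {ν : RatCurve d} {t : ℝ} (hν : ν.DefinedAt t)
    (i j : S') :
    val t (gram S' ν i j) = inner ℝ ((i : Pt d) - ν.point t) ((j : Pt d) - ν.point t) := by
  have h : ∀ (s : Pt d) k, RatFunc.C (s k) - ν k ∈ regularSubring t := fun s k =>
    sub_mem (C_mem_regularSubring t _) (hν k)
  rw [gram, val_sum fun k _ => mul_mem (h _ k) (h _ k), PiLp.inner_apply]
  refine Finset.sum_congr rfl fun k _ => ?_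
  rw [val_mul (h _ k) (h _ k), val_sub (C_mem_regularSubring t _) (hν k),
    val_sub (C_mem_regularSubring t _) (hν k), val_C, val_C]
  simp [RatCurve.point_apply, mul_comm]

open scoped Classical in
/-- The Gram determinant of `S'` is nonzero at `t` iff `S'` and the mobile point are affinely
independent at that time. -/
lemma val_det_gram_ne_zero_iff {d : ℕ} {S' : Finset (Pt d)} {ν : RatCurve d} {t : ℝ}
    (hν : ν.DefinedAt t) :
    val t (gram S' ν).det ≠ 0 ↔ LinearIndependent ℝ (fun j : S' => (j : Pt d) - ν.point t) := by
  rw [(det_mem_regularSubring (gram_mem_regularSubring hν)).2,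
    ← Matrix.det_gram_ne_zero_iff_linearIndependent (𝕜 := ℝ)]
  have : (Matrix.of fun i j => val t (gram S' ν i j)) =
      Matrix.gram ℝ (fun j : S' => (j : Pt d) - ν.point t) := by
    ext i j
    exact val_gram hν i j
  rw [this]

open scoped Classical in
/-- The affine coordinates of the circumcenter curve, by Cramer's rule. They are `0`, and
meaningless, if the Gram determinant vanishes identically. -/
def weight {d : ℕ} (S' : Finset (Pt d)) (ν : RatCurve d) (j : S') : RatFunc ℝ :=
  ((gram S' ν).updateCol j fun i => gram S' ν i i / 2).det / (gram S' ν).det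

open scoped Classical in
lemma sum_gram_mul_weight {d : ℕ} {S' : Finset (Pt d)} {ν : RatCurve d}
    (hdet : (gram S' ν).det ≠ 0) (i : S') :
    ∑ j, gram S' ν i j * weight S' ν j = gram S' ν i i / 2 := by
  have h := congrFun (Matrix.mulVec_cramer (gram S' ν) fun i => gram S' ν i i / 2) i
  simp only [Matrix.mulVec, dotProduct, Matrix.cramer_apply, Pi.smul_apply, smul_eq_mul] at h
  simp only [weight, mul_div_assoc', ← Finset.sum_div]
  rw [h, mul_div_cancel_left₀ _ hdet]

lemma circumcenterCurve_definedAt {d : ℕ} {S' : Finset (Pt d)} {ν : RatCurve d} {t : ℝ}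
    (hν : ν.DefinedAt t) (hw : ∀ j, weight S' ν j ∈ regularSubring t) :
    (circumcenterCurve S' ν).DefinedAt t := fun k =>
  add_mem (hν k) (Subring.sum_mem _ fun j _ => mul_mem (hw j)
    (sub_mem (C_mem_regularSubring t _) (hν k)))

lemma circumcenterCurve_point {d : ℕ} {S' : Finset (Pt d)} {ν : RatCurve d} {t : ℝ}
    (hν : ν.DefinedAt t) (hw : ∀ j, weight S' ν j ∈ regularSubring t) :
    (circumcenterCurve S' ν).point t =
      basedPoint (ν.point t) (fun j => val t (weight S' ν j)) := by
  ext k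
  have h1 : ∀ j : S', RatFunc.C ((j : Pt d) k) - ν k ∈ regularSubring t := fun j =>
    sub_mem (C_mem_regularSubring t _) (hν k)
  have h2 : circumcenterCurve S' ν k =
      ν k + ∑ j : S', weight S' ν j * (RatFunc.C ((j : Pt d) k) - ν k) := rfl
  rw [RatCurve.point_apply, h2, val_add (hν k) (Subring.sum_mem _ fun j _ => mul_mem (hw j) (h1 j)),
    val_sum fun j _ => mul_mem (hw j) (h1 j)]
  simp only [basedPoint, PiLp.add_apply, WithLp.ofLp_sum, Finset.sum_apply, PiLp.smul_apply,
    PiLp.sub_apply, smul_eq_mul, RatCurve.point_apply]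
  congr 1
  refine Finset.sum_congr rfl fun j _ => ?_
  rw [val_mul (hw j) (h1 j), val_sub (C_mem_regularSubring t _) (hν k), val_C]

lemma dist_eq_iff_inner {E : Type*} [NormedAddCommGroup E] [InnerProductSpace ℝ E] (s x c : E) :
    dist s c = dist x c ↔ inner ℝ (s - x) (c - x) = inner ℝ (s - x) (s - x) / 2 := by
  rw [← pow_left_inj₀ dist_nonneg dist_nonneg two_ne_zero, dist_eq_norm, dist_comm x c,
    dist_eq_norm]
  have : s - c = (s - x) - (c - x) := by abel
  rw [this, norm_sub_sq_real, real_inner_self_eq_norm_sq]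
  constructor <;> intro h <;> linarith

lemma inner_basedPoint_sub {d : ℕ} {S' : Finset (Pt d)} (x v : Pt d) (w : S' → ℝ) :
    inner ℝ v (basedPoint x w - x) = ∑ j : S', inner ℝ v ((j : Pt d) - x) * w j := by
  rw [basedPoint, add_sub_cancel_left, inner_sum]
  refine Finset.sum_congr rfl fun j _ => ?_
  rw [inner_smul_right, mul_comm]

/-- The circumcenter curve is equidistant from the mobile point and the points of `S'`, also where
these are affinely dependent, as long as the affine coordinates have no pole. -/
lemma dist_circumcenterCurve {d : ℕ} {S' : Finset (Pt d)} {ν : RatCurve d} {t : ℝ}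
    (hdet : (open scoped Classical in (gram S' ν).det) ≠ 0)
    (hν : ν.DefinedAt t) (hw : ∀ j, weight S' ν j ∈ regularSubring t) (s : Pt d) (hs : s ∈ S') :
    dist s ((circumcenterCurve S' ν).point t) =
      dist (ν.point t) ((circumcenterCurve S' ν).point t) := by
  rw [dist_eq_iff_inner, circumcenterCurve_point hν hw, inner_basedPoint_sub]
  have h := congrArg (val t) (sum_gram_mul_weight hdet ⟨s, hs⟩)
  have hg := gram_mem_regularSubring (S' := S') hν
  rw [val_sum fun j _ => mul_mem (hg _ j) (hw j)] at h
  have h2 : val t (gram S' ν ⟨s, hs⟩ ⟨s, hs⟩ / 2) = val t (gram S' ν ⟨s, hs⟩ ⟨s, hs⟩) / 2 := by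
    have : gram S' ν ⟨s, hs⟩ ⟨s, hs⟩ / 2 = gram S' ν ⟨s, hs⟩ ⟨s, hs⟩ * RatFunc.C (1 / 2) := by
      rw [map_div₀, map_one, map_ofNat, mul_one_div]
    rw [this, val_mul (hg _ _) (C_mem_regularSubring t _), val_C]
    ring
  rw [h2, val_gram hν] at h
  rw [← h]
  refine Finset.sum_congr rfl fun j _ => ?_
  rw [val_mul (hg _ j) (hw j), val_gram hν]

/-- There is only one point in the affine hull of `S' ∪ {x}` that is equidistant from these points.
Affine independence is not needed. -/
lemma eq_of_equidistant {d : ℕ} {S' : Finset (Pt d)} {x : Pt d} {w w' : S' → ℝ}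
    (h : ∀ s ∈ S', dist s (basedPoint x w) = dist x (basedPoint x w))
    (h' : ∀ s ∈ S', dist s (basedPoint x w') = dist x (basedPoint x w')) :
    basedPoint x w = basedPoint x w' := by
  have h1 : ∀ v : Pt d, inner ℝ v (basedPoint x w - basedPoint x w') =
      inner ℝ v (basedPoint x w - x) - inner ℝ v (basedPoint x w' - x) := fun v => by
    rw [← inner_sub_right, sub_sub_sub_cancel_right]
  have h2 : ∀ j : S', inner ℝ ((j : Pt d) - x) (basedPoint x w - basedPoint x w') = 0 := fun j => by
    rw [h1, (dist_eq_iff_inner _ _ _).1 (h j j.2), (dist_eq_iff_inner _ _ _).1 (h' j j.2), sub_self]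
  rw [← sub_eq_zero, ← inner_self_eq_zero (𝕜 := ℝ), h1, inner_basedPoint_sub, inner_basedPoint_sub]
  simp [real_inner_comm, h2]

lemma weight_eq_of_basedPoint_eq {d : ℕ} {S' : Finset (Pt d)} {x : Pt d} {w w' : S' → ℝ}
    (hli : LinearIndependent ℝ (fun j : S' => (j : Pt d) - x))
    (h : basedPoint x w = basedPoint x w') : w = w' := by
  have h1 : ∑ j : S', (w j - w' j) • ((j : Pt d) - x) = 0 := by
    simp only [sub_smul, Finset.sum_sub_distrib]
    simpa [basedPoint, sub_smul, sub_eq_zero] using h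
  funext j
  exact sub_eq_zero.1 (Fintype.linearIndependent_iff.1 hli _ h1 j)

/-- Near any parameter the mobile point is defined, affinely independent from `S'`, and the
coordinates of the circumcenter have no pole, unless the Gram determinant vanishes identically. -/
lemma eventually_linearIndependent {d : ℕ} {S' : Finset (Pt d)} {ν : RatCurve d}
    (hdet : (open scoped Classical in (gram S' ν).det) ≠ 0) (t₀ : ℝ) :
    ∀ᶠ t in 𝓝[≠] t₀, ν.DefinedAt t ∧ (∀ j, weight S' ν j ∈ regularSubring t) ∧
      LinearIndependent ℝ (fun j : S' => (j : Pt d) - ν.point t) := by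
  filter_upwards [ν.eventually_definedAt t₀, eventually_val_ne_zero hdet t₀,
    eventually_all.2 fun j => eventually_mem_regularSubring (weight S' ν j) t₀] with t h1 h2 h3
  exact ⟨h1, h3, (val_det_gram_ne_zero_iff h1).1 h2⟩

lemma det_gram_ne_zero {d : ℕ} {S' : Finset (Pt d)} {ν : RatCurve d} {t : ℝ}
    (hν : ν.DefinedAt t) (hli : LinearIndependent ℝ (fun j : S' => (j : Pt d) - ν.point t)) :
    (open scoped Classical in (gram S' ν).det) ≠ 0 := by
  intro h
  exact (val_det_gram_ne_zero_iff hν).2 hli (by rw [h]; simp)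

lemma weight_mem_regularSubring {d : ℕ} {S' : Finset (Pt d)} {ν : RatCurve d} {t : ℝ}
    (hν : ν.DefinedAt t) (hli : LinearIndependent ℝ (fun j : S' => (j : Pt d) - ν.point t))
    (j : S') : weight S' ν j ∈ regularSubring t := by
  classical
  have hg := gram_mem_regularSubring (S' := S') hν
  refine div_mem_regularSubring (det_mem_regularSubring fun i k => ?_).1
    ((val_det_gram_ne_zero_iff hν).2 hli)
  rw [Matrix.updateCol_apply]
  split_ifs
  · have : gram S' ν i i / 2 = gram S' ν i i * RatFunc.C (1 / 2) := by
      rw [map_div₀, map_one, map_ofNat, mul_one_div]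
    rw [this]
    exact mul_mem (hg i i) (C_mem_regularSubring t _)
  · exact hg i k

/-- The test for support sets in terms of the rational affine coordinates of the circumcenter. -/
lemma isSupport_point_iff {d : ℕ} {S S' : Finset (Pt d)} {ν : RatCurve d} {t : ℝ}
    (hν : ν.DefinedAt t) (hli : LinearIndependent ℝ (fun j : S' => (j : Pt d) - ν.point t)) :
    IsSupport S S' (ν.point t) ↔ S' ⊆ S ∧ S'.Nonempty ∧ (∀ j, 0 ≤ val t (weight S' ν j)) ∧
      ∑ j, val t (weight S' ν j) ≤ 1 ∧
      ∀ l ∈ S, dist l ((circumcenterCurve S' ν).point t) ≤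
        dist (ν.point t) ((circumcenterCurve S' ν).point t) := by
  have hw := weight_mem_regularSubring hν hli
  have hd := dist_circumcenterCurve (det_gram_ne_zero hν hli) hν hw
  rw [circumcenterCurve_point hν hw] at hd ⊢
  rw [isSupport_iff]
  constructor
  · rintro ⟨h1, h2, -, w, h3, h4, h5, h6⟩
    obtain rfl := weight_eq_of_basedPoint_eq hli (eq_of_equidistant h5 hd)
    exact ⟨h1, h2, h3, h4, h6⟩
  · rintro ⟨h1, h2, h3, h4, h5⟩
    exact ⟨h1, h2, hli, _, h3, h4, hd, h5⟩

lemma IsSupport.linearIndependent {d : ℕ} {S S' : Finset (Pt d)} {x : Pt d}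
    (h : IsSupport S S' x) : LinearIndependent ℝ (fun j : S' => (j : Pt d) - x) :=
  (isSupport_iff.1 h).2.2.1

lemma meromorphicAt_sum_weight {d : ℕ} (S' : Finset (Pt d)) (ν : RatCurve d) (t₀ : ℝ) :
    MeromorphicAt (fun t => ∑ j, val t (weight S' ν j)) t₀ :=
  MeromorphicAt.fun_sum fun j _ => meromorphicAt_val (weight S' ν j) t₀

lemma decides_isSupport {d : ℕ} (S S' : Finset (Pt d)) (ν : RatCurve d) {t₀ : ℝ} {F : Filter ℝ}
    (hF : IsSide t₀ F) : Decides F fun t => IsSupport S S' (ν.point t) := by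
  classical
  by_cases hdet : (open scoped Classical in (gram S' ν).det) = 0
  · refine Or.inr (hF.le ?_)
    filter_upwards [ν.eventually_definedAt t₀] with t ht h
    exact det_gram_ne_zero ht h.linearIndependent hdet
  · refine Decides.congr (p := fun t => S' ⊆ S ∧ S'.Nonempty ∧ (∀ j, 0 ≤ val t (weight S' ν j)) ∧
      ∑ j, val t (weight S' ν j) ≤ 1 ∧
      ∀ l ∈ S, dist l ((circumcenterCurve S' ν).point t) ≤
        dist (ν.point t) ((circumcenterCurve S' ν).point t)) ?_ ?_
    · refine (Decides.const F _).and ((Decides.const F _).and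
        ((Decides.forall_finite fun j => decides_nonneg hF (meromorphicAt_val _ _)).and
        ((decides_le hF (meromorphicAt_sum_weight S' ν t₀) (MeromorphicAt.const 1 t₀)).and
        (Decides.forall_finset fun l _ => ?_))))
      simpa only [RatCurve.const_point] using
        decides_dist_le (RatCurve.const l) (circumcenterCurve S' ν) ν (circumcenterCurve S' ν) hF
    · filter_upwards [hF.le (eventually_linearIndependent hdet t₀)] with t ht
      exact (isSupport_point_iff ht.1 ht.2.2).symm

/-! ### Limits of the arc of a support set -/

/-- What remains true of a support set in a one-sided limit: the affine coordinates, being bounded,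
have no pole, and the weak inequalities of the test are inherited. Affine independence may be
lost. -/
lemma isSupport_limit {d : ℕ} {S S' : Finset (Pt d)} {ν : RatCurve d} {t₀ : ℝ} {F : Filter ℝ}
    (hF : IsSide t₀ F) (hν : ν.DefinedAt t₀) (h : ∀ᶠ t in F, IsSupport S S' (ν.point t)) :
    S' ⊆ S ∧ S'.Nonempty ∧ (open scoped Classical in (gram S' ν).det) ≠ 0 ∧
      (∀ j, weight S' ν j ∈ regularSubring t₀) ∧ (∀ j, 0 ≤ val t₀ (weight S' ν j)) ∧
      ∑ j, val t₀ (weight S' ν j) ≤ 1 ∧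
      ∀ l ∈ S, dist l ((circumcenterCurve S' ν).point t₀) ≤
        dist (ν.point t₀) ((circumcenterCurve S' ν).point t₀) := by
  have := hF.neBot
  have hF' : F ≤ 𝓝 t₀ := hF.le.trans nhdsWithin_le_nhds
  have hdef := hF.le (ν.eventually_definedAt t₀)
  obtain ⟨t₁, h₁, hν₁⟩ := (h.and hdef).exists
  have h' : ∀ᶠ t in F, (∀ j, 0 ≤ val t (weight S' ν j)) ∧ ∑ j, val t (weight S' ν j) ≤ 1 ∧
      ∀ l ∈ S, dist l ((circumcenterCurve S' ν).point t) ≤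
        dist (ν.point t) ((circumcenterCurve S' ν).point t) := by
    filter_upwards [h, hdef] with t ht hνt
    exact ((isSupport_point_iff hνt ht.linearIndependent).1 ht).2.2
  have hreg : ∀ j, weight S' ν j ∈ regularSubring t₀ := fun j => by
    refine mem_regularSubring_of_bounded hF.le (b := 1) ?_
    filter_upwards [h'] with t ht
    rw [abs_of_nonneg (ht.1 j)]
    exact (Finset.single_le_sum (f := fun j => val t (weight S' ν j)) (fun i _ => ht.1 i)
      (Finset.mem_univ j)).trans ht.2.1
  have hwt : ∀ j, Tendsto (fun t => val t (weight S' ν j)) F (𝓝 (val t₀ (weight S' ν j))) :=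
    fun j => (continuousAt_val (hreg j)).tendsto.mono_left hF'
  have hξ : Tendsto (circumcenterCurve S' ν).point F (𝓝 ((circumcenterCurve S' ν).point t₀)) :=
    (RatCurve.continuousAt_point (circumcenterCurve_definedAt hν hreg)).tendsto.mono_left hF'
  have hνt : Tendsto ν.point F (𝓝 (ν.point t₀)) :=
    (RatCurve.continuousAt_point hν).tendsto.mono_left hF'
  refine ⟨(isSupport_iff.1 h₁).1, (isSupport_iff.1 h₁).2.1,
    det_gram_ne_zero hν₁ h₁.linearIndependent, hreg, fun j => ?_, ?_, fun l hl => ?_⟩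
  · exact ge_of_tendsto (hwt j) (h'.mono fun t ht => ht.1 j)
  · exact le_of_tendsto (tendsto_finsetSum _ fun j _ => hwt j) (h'.mono fun t ht => ht.2.1)
  · exact le_of_tendsto_of_tendsto (tendsto_const_nhds.dist hξ) (hνt.dist hξ)
      (h'.mono fun t ht => ht.2.2 l hl)

/-- Where `S'` is a support set on one side, the circumcenter curve passes through the center of
the smallest enclosing ball. -/
lemma isSEB_of_isSupport {d : ℕ} {S S' : Finset (Pt d)} {ν : RatCurve d} {t₀ : ℝ} {F : Filter ℝ}
    (hF : IsSide t₀ F) (hν : ν.DefinedAt t₀) (h : ∀ᶠ t in F, IsSupport S S' (ν.point t)) :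
    (circumcenterCurve S' ν).DefinedAt t₀ ∧
      ∃ r, IsSEB (insert (ν.point t₀) (S : Set (Pt d))) ((circumcenterCurve S' ν).point t₀) r := by
  obtain ⟨h1, -, hdet, hreg, h2, h3, h4⟩ := isSupport_limit hF hν h
  refine ⟨circumcenterCurve_definedAt hν hreg,
    dist (ν.point t₀) ((circumcenterCurve S' ν).point t₀), ?_⟩
  have hd := dist_circumcenterCurve hdet hν hreg
  rw [circumcenterCurve_point hν hreg] at h4 hd ⊢
  exact isSEB_insert h1 h2 h3 hd h4

lemma basedPoint_extend {d : ℕ} {S' S'' : Finset (Pt d)} [DecidableEq (Pt d)] (hS : S'' ⊆ S')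
    (x : Pt d) (w : S'' → ℝ) :
    basedPoint x (fun j : S' => if h : (j : Pt d) ∈ S'' then w ⟨j, h⟩ else 0) = basedPoint x w := by
  have h1 : ∑ j : S', (if h : (j : Pt d) ∈ S'' then w ⟨j, h⟩ else 0) • ((j : Pt d) - x) =
      ∑ s ∈ S', (if h : s ∈ S'' then w ⟨s, h⟩ else 0) • (s - x) :=
    Finset.sum_coe_sort S' fun s => (if h : s ∈ S'' then w ⟨s, h⟩ else 0) • (s - x)
  have h2 : ∑ j : S'', w j • ((j : Pt d) - x) =
      ∑ s ∈ S'', (if h : s ∈ S'' then w ⟨s, h⟩ else 0) • (s - x) := by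
    rw [← Finset.sum_coe_sort S'' fun s => (if h : s ∈ S'' then w ⟨s, h⟩ else 0) • (s - x)]
    exact Finset.sum_congr rfl fun j _ => by rw [dif_pos j.2]
  rw [basedPoint, basedPoint, h1, h2]
  congr 1
  exact (Finset.sum_subset hS fun s _ hs => by rw [dif_neg hs, zero_smul]).symm

/-- If the affine coordinate at `j` becomes negative, the curve meets the circumcenter curve of
a smaller set `S''`: one for which the vectors `s - ν(t₀)` form a basis of the span of those
for the points other than `j`. Passing to a basis matters only where the mobile point becomes
affinely dependent on `S'`, for example where it touches a point of `S'`. -/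
lemma exists_curvesMeetAt {d : ℕ} {S' : Finset (Pt d)} {ν : RatCurve d} {t₀ : ℝ}
    (hν : ν.DefinedAt t₀) (hdet : (open scoped Classical in (gram S' ν).det) ≠ 0)
    (hreg : ∀ j, weight S' ν j ∈ regularSubring t₀)
    (hne : (circumcenterCurve S' ν).point t₀ ≠ ν.point t₀) (j : S')
    (hj0 : val t₀ (weight S' ν j) = 0) (hj : ∀ᶠ t in 𝓝[>] t₀, val t (weight S' ν j) < 0) :
    ∃ S'' : Finset (Pt d), S''.Nonempty ∧ S'' ⊂ S' ∧
      CurvesMeetAt (circumcenterCurve S'' ν) (circumcenterCurve S' ν) t₀ := by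
  classical
  set x := ν.point t₀ with hx
  obtain ⟨b, hb, -, hspan, hli⟩ := exists_linearIndepOn_extension
    (linearIndepOn_empty ℝ (fun s : Pt d => s - x))
    (Set.empty_subset ((S'.erase j : Finset (Pt d)) : Set (Pt d)))
  obtain ⟨S'', rfl⟩ : ∃ S'' : Finset (Pt d), (S'' : Set (Pt d)) = b :=
    ((Finset.finite_toSet _).subset hb).exists_finset_coe
  have hS'' : S'' ⊆ S'.erase j := by exact_mod_cast hb
  have hsub : S'' ⊆ S' := hS''.trans (Finset.erase_subset _ _)
  have hlin : LinearIndependent ℝ (fun s : S'' => (s : Pt d) - x) := hli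
  have hpt := circumcenterCurve_point hν hreg
  have hmem : (circumcenterCurve S' ν).point t₀ - x ∈
      Submodule.span ℝ (Set.range fun s : S'' => (s : Pt d) - x) := by
    have hrange : (Set.range fun s : S'' => (s : Pt d) - x) =
        (fun s : Pt d => s - x) '' (S'' : Set (Pt d)) := by
      ext v
      simp
    rw [hrange, hpt, basedPoint, ← hx, add_sub_cancel_left]
    refine Submodule.sum_mem _ fun i _ => ?_
    by_cases hij : i = j
    · rw [hij, hj0, zero_smul]
      exact Submodule.zero_mem _
    · refine Submodule.smul_mem _ _ (hspan ⟨i, ?_, rfl⟩)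
      rw [Finset.mem_coe, Finset.mem_erase]
      exact ⟨fun h => hij (Subtype.ext h), i.2⟩
  obtain ⟨w, hw⟩ := (Submodule.mem_span_range_iff_exists_fun ℝ).1 hmem
  have hw' : (circumcenterCurve S' ν).point t₀ = basedPoint x w := by
    rw [basedPoint, hw, add_sub_cancel]
  refine ⟨S'', ?_, ?_, ⟨?_, ?_, ?_⟩, ?_⟩
  · rw [Finset.nonempty_iff_ne_empty]
    rintro rfl
    exact hne (by simpa [basedPoint] using hw')
  · exact (Finset.ssubset_iff_of_subset hsub).2
      ⟨j, j.2, fun h => (Finset.mem_erase.1 (hS'' h)).1 rfl⟩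
  · exact circumcenterCurve_definedAt hν (weight_mem_regularSubring hν hlin)
  · exact circumcenterCurve_definedAt hν hreg
  · have h1 := dist_circumcenterCurve (det_gram_ne_zero hν hlin) hν
      (weight_mem_regularSubring hν hlin)
    have h2 := dist_circumcenterCurve hdet hν hreg
    rw [hw'] at h2 ⊢
    rw [circumcenterCurve_point hν (weight_mem_regularSubring hν hlin)] at h1 ⊢
    exact eq_of_equidistant h1 fun s hs => h2 s (hsub hs)
  · rcases (meromorphicAt_dist_sq (circumcenterCurve S'' ν) (circumcenterCurve S' ν)
      t₀).eventually_eq_zero_or_eventually_ne_zero with h | h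
    · -- otherwise the two curves agree and the coordinate at `j` vanishes near `t₀`
      exfalso
      have hle := (isSide_right t₀).le
      obtain ⟨t, ht, hjt, ⟨hνt, hregt, hlit⟩, -, hregt', -⟩ := ((h.filter_mono hle).and (hj.and
        ((eventually_linearIndependent hdet t₀ |>.filter_mono hle).and
        (hle (eventually_linearIndependent (det_gram_ne_zero hν hlin) t₀))))).exists
      have heq := dist_eq_zero.1 (pow_eq_zero_iff two_ne_zero |>.1 ht)
      rw [circumcenterCurve_point hνt hregt, circumcenterCurve_point hνt hregt',
        ← basedPoint_extend hsub] at heq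
      have := congrFun (weight_eq_of_basedPoint_eq hlit heq) j
      rw [dif_neg fun h => (Finset.mem_erase.1 (hS'' h)).1 rfl] at this
      linarith
    · filter_upwards [h] with t ht hmeet
      exact ht (by rw [hmeet.2.2, dist_self]; norm_num)

/-- If a point of `S` leaves the ball, the circumcenter curve meets the Voronoi face of the set of
all points of `S` at the maximal distance. -/
lemma exists_curveMeetsSetAt {d : ℕ} {S S' : Finset (Pt d)} {ν : RatCurve d} {t₀ : ℝ}
    (hν : ν.DefinedAt t₀) (hS' : S' ⊆ S) (hne : S'.Nonempty)
    (hdet : (open scoped Classical in (gram S' ν).det) ≠ 0)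
    (hreg : ∀ j, weight S' ν j ∈ regularSubring t₀)
    (hS : ∀ l ∈ S, dist l ((circumcenterCurve S' ν).point t₀) ≤
        dist (ν.point t₀) ((circumcenterCurve S' ν).point t₀)) {l : Pt d} (hlS : l ∈ S)
    (hl : ∀ᶠ t in 𝓝[>] t₀, dist (ν.point t) ((circumcenterCurve S' ν).point t) <
      dist l ((circumcenterCurve S' ν).point t)) :
    ∃ P : Finset (Pt d), S' ⊂ P ∧ P ⊆ S ∧
        CurveMeetsSetAt (circumcenterCurve S' ν) (voronoiFace S P) t₀ := by
  classical
  set ξ := circumcenterCurve S' ν with hξdef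
  have hdef : ξ.DefinedAt t₀ := circumcenterCurve_definedAt hν hreg
  have hle := (isSide_right t₀).le
  have hle' : 𝓝[>] t₀ ≤ 𝓝 t₀ := nhdsWithin_le_nhds
  have hξ : Tendsto ξ.point (𝓝[>] t₀) (𝓝 (ξ.point t₀)) :=
    (RatCurve.continuousAt_point hdef).tendsto.mono_left hle'
  have hνt : Tendsto ν.point (𝓝[>] t₀) (𝓝 (ν.point t₀)) :=
    (RatCurve.continuousAt_point hν).tendsto.mono_left hle'
  have hd := dist_circumcenterCurve hdet hν hreg
  have hlt₀ : dist l (ξ.point t₀) = dist (ν.point t₀) (ξ.point t₀) :=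
    le_antisymm (hS l hlS) (le_of_tendsto_of_tendsto (hνt.dist hξ) (tendsto_const_nhds.dist hξ)
      (hl.mono fun t ht => ht.le))
  have hlS' : l ∉ S' := by
    intro h
    obtain ⟨t, ht, hνt, hregt, -⟩ :=
      (hl.and (hle (eventually_linearIndependent hdet t₀))).exists
    exact ht.ne' (dist_circumcenterCurve hdet hνt hregt l h)
  let P := S.filter fun s => dist s (ξ.point t₀) = dist (ν.point t₀) (ξ.point t₀)
  have hS'P : S' ⊆ P := fun s hs => Finset.mem_filter.2 ⟨hS' hs, hd s hs⟩
  have hlP : l ∈ P := Finset.mem_filter.2 ⟨hlS, hlt₀⟩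
  refine ⟨P, (Finset.ssubset_iff_of_subset hS'P).2 ⟨l, hlP, hlS'⟩, Finset.filter_subset _ _,
    ⟨hdef, fun p hp p' hp' => ?_, fun p hp l' hl' hlp' => ?_⟩, ?_⟩
  · rw [dist_comm _ p, dist_comm _ p', (Finset.mem_filter.1 hp).2, (Finset.mem_filter.1 hp').2]
  · rw [dist_comm _ p, dist_comm _ l', (Finset.mem_filter.1 hp).2]
    exact lt_of_le_of_ne (hS l' hl') fun h => hlp' (Finset.mem_filter.2 ⟨hl', h⟩)
  · obtain ⟨s, hs⟩ := hne
    have hmero := (meromorphicAt_dist_sq_left ξ l t₀).sub (meromorphicAt_dist_sq ν ξ t₀)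
    rcases hmero.eventually_eq_zero_or_eventually_ne_zero with h | h
    · exfalso
      obtain ⟨t, ht, hlt⟩ := ((h.filter_mono hle).and hl).exists
      have := pow_lt_pow_left₀ hlt dist_nonneg two_ne_zero
      simp only [Pi.sub_apply] at ht
      linarith
    · filter_upwards [h, eventually_linearIndependent hdet t₀] with t ht ⟨hνt, hregt, _⟩ hmem
      refine ht ?_
      have h1 := hmem.2.1 l hlP s (hS'P hs)
      rw [dist_comm _ l, dist_comm _ s] at h1
      rw [Pi.sub_apply, h1, dist_circumcenterCurve hdet hνt hregt s hs, sub_self]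

/-! ### Crossing the boundary of the ball -/

/-- The squared distance of the mobile point from the center, minus the squared radius, is a
meromorphic function that vanishes on the boundary of the ball. -/
lemma meromorphicAt_power {d : ℕ} (ν : RatCurve d) (o : Pt d) (R t₀ : ℝ) :
    MeromorphicAt (fun t => dist (ν.point t) o ^ 2 - R ^ 2) t₀ := by
  have := (meromorphicAt_dist_sq ν (RatCurve.const o) t₀).sub (MeromorphicAt.const (R ^ 2) t₀)
  simp only [RatCurve.const_point] at this
  exact this

/-- The mobile point stays on the sphere near `t₀`, or it is off the sphere near `t₀`. -/
lemma eventually_sphere_or {d : ℕ} (ν : RatCurve d) (o : Pt d) {R : ℝ} (hR : 0 ≤ R) (t₀ : ℝ) :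
    (∀ᶠ t in 𝓝[≠] t₀, dist (ν.point t) o = R) ∨ ∀ᶠ t in 𝓝[≠] t₀, dist (ν.point t) o ≠ R := by
  rcases (meromorphicAt_power ν o R t₀).eventually_eq_zero_or_eventually_ne_zero with h | h
  · exact Or.inl (h.mono fun t ht =>
      (pow_left_inj₀ dist_nonneg hR two_ne_zero).1 (sub_eq_zero.1 ht))
  · exact Or.inr (h.mono fun t ht h' => ht (by rw [h', sub_self]))

lemma decides_mem_ball {d : ℕ} (ν : RatCurve d) (o : Pt d) {R : ℝ} (hR : 0 ≤ R) {t₀ : ℝ}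
    {F : Filter ℝ} (hF : IsSide t₀ F) : Decides F fun t => ν.point t ∈ Metric.ball o R := by
  refine ((decides_nonneg hF (meromorphicAt_power ν o R t₀)).not).congr
    (Eventually.of_forall fun t => ?_)
  rw [not_le, sub_neg, Metric.mem_ball, pow_lt_pow_iff_left₀ dist_nonneg hR two_ne_zero]

/-- If the mobile point is in the interior of the ball on one side of `t₀` and not on the other,
it crosses the boundary at `t₀`. -/
lemma crossing {d : ℕ} {ν : RatCurve d} {o : Pt d} {R : ℝ} (hR : 0 ≤ R) {t₀ : ℝ}
    (hν : ν.DefinedAt t₀) {F G : Filter ℝ} (hF : IsSide t₀ F) (hG : IsSide t₀ G)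
    (hin : ∀ᶠ t in F, ν.point t ∈ Metric.ball o R)
    (hout : ∀ᶠ t in G, ν.point t ∉ Metric.ball o R) :
    ν.point t₀ ∈ Metric.sphere o R ∧ ∀ᶠ t in G, ν.point t ∉ Metric.closedBall o R := by
  have := hF.neBot
  have := hG.neBot
  have hlim : ∀ {H : Filter ℝ}, IsSide t₀ H →
      Tendsto (fun t => dist (ν.point t) o) H (𝓝 (dist (ν.point t₀) o)) := fun hH =>
    ((RatCurve.continuousAt_point hν).tendsto.mono_left
      (hH.le.trans nhdsWithin_le_nhds)).dist tendsto_const_nhds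
  refine ⟨le_antisymm (le_of_tendsto (hlim hF) (hin.mono fun t ht => (Metric.mem_ball.1 ht).le))
    (ge_of_tendsto (hlim hG) (hout.mono fun t ht => not_lt.1 ht)), ?_⟩
  rcases eventually_sphere_or ν o hR t₀ with h | h
  · obtain ⟨t, ht, ht'⟩ := (hin.and (hF.le h)).exists
    exact absurd ht' (Metric.mem_ball.1 ht).ne
  · filter_upwards [hout, hG.le h] with t h1 h2 h3
    exact h1 (lt_of_le_of_ne h3 h2)

/-- If the affine coordinate at the mobile point becomes negative, the mobile point enters the
ball of `S`. -/
lemma isInPoint_of_one_lt_sum {d : ℕ} {S S' : Finset (Pt d)} {o : Pt d} {R : ℝ}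
    (hB : IsSEB (S : Set (Pt d)) o R) {ν : RatCurve d} {t₀ : ℝ} (hν : ν.DefinedAt t₀)
    (hL : ∀ᶠ t in 𝓝[<] t₀, IsSupport S S' (ν.point t))
    (hsum : ∀ᶠ t in 𝓝[>] t₀, 1 < ∑ j, val t (weight S' ν j)) : IsInPoint o R ν t₀ := by
  obtain ⟨hS', ⟨s₀, hs₀⟩, hdet, hreg, h0, h1, hS⟩ := isSupport_limit (isSide_left t₀) hν hL
  have hR : 0 ≤ R := dist_nonneg.trans (hB.1 (hS' hs₀))
  have hle := (isSide_right t₀).le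
  have hd := dist_circumcenterCurve hdet hν hreg
  have hpt := circumcenterCurve_point hν hreg
  have h1' : ∑ j, val t₀ (weight S' ν j) = 1 := by
    refine le_antisymm h1 (ge_of_tendsto (tendsto_finsetSum _ fun j _ =>
      (continuousAt_val (hreg j)).tendsto.mono_left
        (nhdsWithin_le_nhds (s := Set.Ioi t₀))) (hsum.mono fun t ht => ht.le))
  have hc : ∑ j : S', val t₀ (weight S' ν j) • (j : Pt d) = (circumcenterCurve S' ν).point t₀ := by
    rw [hpt, basedPoint]
    simp only [smul_sub, Finset.sum_sub_distrib, ← Finset.sum_smul, h1']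
    module
  -- at `t₀` the center lies in the convex hull of `S'`, so that the ball is the one of `S`
  obtain ⟨ho, hRr⟩ := hB.eq_of_weights (w := fun j => val t₀ (weight S' ν j))
    (p := fun j : S' => (j : Pt d)) ⟨h0, h1'⟩ (fun j _ => hS' j.2) hc (fun j _ => hd j j.2) hS
  rw [ho] at hc hd
  rw [ho] at hRr
  -- afterwards the power of the mobile point is nonpositive
  have hpow : ∀ᶠ t in 𝓝[>] t₀, (1 - ∑ j, val t (weight S' ν j)) *
      (dist (ν.point t) o ^ 2 - R ^ 2) =
        2 * dist ((circumcenterCurve S' ν).point t) o ^ 2 := by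
    filter_upwards [hle (eventually_linearIndependent hdet t₀)] with t ⟨hνt, hregt, _⟩
    have hdt := dist_circumcenterCurve hdet hνt hregt
    rw [circumcenterCurve_point hνt hregt] at hdt ⊢
    exact one_sub_sum_mul_power h1' hc (fun j => (hd j j.2).trans hRr) hdt
  -- the mobile point does not stay on the sphere, as the coordinates would be constant
  have hoff : ∀ᶠ t in 𝓝[≠] t₀, dist (ν.point t) o ≠ R := by
    refine (eventually_sphere_or ν o hR t₀).resolve_left fun hon => ?_
    obtain ⟨t, ⟨hνt, hregt, hlit⟩, ht1, ht2, ht3⟩ :=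
      ((eventually_linearIndependent hdet t₀ |>.filter_mono hle).and
        (hsum.and (hpow.and (hle hon)))).exists
    rw [ht3, sub_self, mul_zero] at ht2
    have hξo : (circumcenterCurve S' ν).point t = o := by
      rw [← dist_eq_zero, ← pow_eq_zero_iff two_ne_zero]
      linarith
    have hob : o = basedPoint (ν.point t) (fun j => val t₀ (weight S' ν j)) := by
      rw [basedPoint]
      simp only [smul_sub, Finset.sum_sub_distrib, ← Finset.sum_smul, h1', hc]
      module
    rw [circumcenterCurve_point hνt hregt, hob] at hξo
    have := weight_eq_of_basedPoint_eq hlit hξo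
    simp only [congrFun this, h1'] at ht1
    exact lt_irrefl _ ht1
  have hin : ∀ᶠ t in 𝓝[>] t₀, ν.point t ∈ Metric.ball o R := by
    filter_upwards [hsum, hpow, hle hoff] with t ht1 ht2 ht3
    refine lt_of_le_of_ne ?_ ht3
    by_contra hlt
    have h3 := pow_lt_pow_left₀ (not_le.1 hlt) hR two_ne_zero
    nlinarith [sq_nonneg (dist ((circumcenterCurve S' ν).point t) o)]
  have hcross := crossing hR hν (isSide_right t₀) (isSide_left t₀) hin
    (hL.mono fun t ht => ht.notMem_ball hB)
  exact ⟨hcross.1, hcross.2, hin⟩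

/-! ### Passing through a parameter that is not a candidate -/

/-- A support set remains one beyond every parameter that is not a candidate. -/
lemma eventually_isSupport_right {d : ℕ} {S S' : Finset (Pt d)} (hcard : 2 ≤ S.card) {o : Pt d}
    {R : ℝ} (hB : IsSEB (S : Set (Pt d)) o R) {ν : RatCurve d} {t₀ : ℝ} (hν : ν.DefinedAt t₀)
    (hL : ∀ᶠ t in 𝓝[<] t₀, IsSupport S S' (ν.point t))
    (hcand : ¬ IsCandidate S o R ν (.outside S') t₀) :
    ∀ᶠ t in 𝓝[>] t₀, IsSupport S S' (ν.point t) := by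
  obtain ⟨hS', hne, hdet, hreg, h0, h1, hS⟩ := isSupport_limit (isSide_left t₀) hν hL
  have hright := isSide_right t₀
  simp only [IsCandidate, not_or] at hcand
  obtain ⟨hin, hcurve, hface⟩ := hcand
  have hξν : (circumcenterCurve S' ν).point t₀ ≠ ν.point t₀ := by
    intro h
    obtain ⟨a, ha, b, hb, hab⟩ := Finset.one_lt_card.1 hcard
    have h2 := hS a ha
    have h3 := hS b hb
    rw [h, dist_self, dist_le_zero] at h2 h3
    exact hab (h2.trans h3.symm)
  have e1 : ∀ᶠ t in 𝓝[>] t₀, ∀ j, 0 ≤ val t (weight S' ν j) := by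
    refine eventually_all.2 fun j => (decides_nonneg hright (meromorphicAt_val _ _)).resolve_right
      fun hneg => hcurve (exists_curvesMeetAt hν hdet hreg hξν j (le_antisymm ?_ (h0 j))
        (hneg.mono fun t ht => not_le.1 ht))
    exact le_of_tendsto ((continuousAt_val (hreg j)).tendsto.mono_left
      (nhdsWithin_le_nhds (s := Set.Ioi t₀))) (hneg.mono fun t ht => (not_le.1 ht).le)
  have e2 : ∀ᶠ t in 𝓝[>] t₀, ∑ j, val t (weight S' ν j) ≤ 1 :=
    (decides_le hright (meromorphicAt_sum_weight S' ν t₀) (MeromorphicAt.const 1 t₀)).resolve_right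
      fun hgt => hin (isInPoint_of_one_lt_sum hB hν hL (hgt.mono fun t ht => not_le.1 ht))
  have e3 : ∀ᶠ t in 𝓝[>] t₀, ∀ l ∈ S, dist l ((circumcenterCurve S' ν).point t) ≤
      dist (ν.point t) ((circumcenterCurve S' ν).point t) := by
    refine (eventually_all_finset S).2 fun l hl => ?_
    have hdec := decides_dist_le (RatCurve.const l) (circumcenterCurve S' ν) ν
      (circumcenterCurve S' ν) hright
    simp only [RatCurve.const_point] at hdec
    exact hdec.resolve_right fun hgt => hface
      (exists_curveMeetsSetAt hν hS' hne hdet hreg hS hl (hgt.mono fun t ht => not_le.1 ht))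
  filter_upwards [e1, e2, e3, hright.le (eventually_linearIndependent hdet t₀)]
    with t t1 t2 t3 ⟨hνt, _, hlit⟩
  exact (isSupport_point_iff hνt hlit).2 ⟨hS', hne, t1, t2, t3⟩

/-! ### Validity of an arc -/

/-- The condition on the position at time `t` that the arc stands for. It is required on one-sided
neighbourhoods only, as it may fail at single parameters of an arc, for example where the mobile
point touches a point of `S`. -/
def ArcValid {d : ℕ} (S : Finset (Pt d)) (o : Pt d) (R : ℝ) (ν : RatCurve d) :
    ArcKind d → ℝ → Prop
  | .inside, t => ν.point t ∈ Metric.ball o R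
  | .outside S', t => IsSupport S S' (ν.point t)

lemma isFirstArc_iff {d : ℕ} {S : Finset (Pt d)} {o : Pt d} {R : ℝ} {ν : RatCurve d}
    {a : ArcKind d} : IsFirstArc S o R ν a ↔ ∀ᶠ t in 𝓝[>] (0 : ℝ), ArcValid S o R ν a t := by
  cases a <;> exact Iff.rfl

lemma decides_arcValid {d : ℕ} (S : Finset (Pt d)) (o : Pt d) {R : ℝ} (hR : 0 ≤ R)
    (ν : RatCurve d) (a : ArcKind d) {t₀ : ℝ} {F : Filter ℝ} (hF : IsSide t₀ F) :
    Decides F (ArcValid S o R ν a) := by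
  cases a with
  | inside => exact decides_mem_ball ν o hR hF
  | outside S' => exact decides_isSupport S S' ν hF

lemma IsSEB.radius_nonneg {d : ℕ} {S : Finset (Pt d)} (hcard : 2 ≤ S.card) {o : Pt d} {R : ℝ}
    (hB : IsSEB (S : Set (Pt d)) o R) : 0 ≤ R := by
  obtain ⟨s, hs⟩ := Finset.card_pos.1 (by omega : 0 < S.card)
  exact dist_nonneg.trans (hB.1 hs)

lemma eventually_arcValid_right {d : ℕ} {S : Finset (Pt d)} (hcard : 2 ≤ S.card) {o : Pt d}
    {R : ℝ} (hB : IsSEB (S : Set (Pt d)) o R) {ν : RatCurve d} {t₀ : ℝ} (hν : ν.DefinedAt t₀)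
    {a : ArcKind d} (hL : ∀ᶠ t in 𝓝[<] t₀, ArcValid S o R ν a t)
    (hcand : ¬ IsCandidate S o R ν a t₀) : ∀ᶠ t in 𝓝[>] t₀, ArcValid S o R ν a t := by
  cases a with
  | inside =>
    have hR := hB.radius_nonneg hcard
    refine (decides_mem_ball ν o hR (isSide_right t₀)).resolve_right fun hout => hcand ?_
    have h := crossing hR hν (isSide_left t₀) (isSide_right t₀) hL hout
    exact ⟨h.1, hL, h.2⟩
  | outside S' => exact eventually_isSupport_right hcard hB hν hL hcand

lemma isSEB_of_arcValid {d : ℕ} {S : Finset (Pt d)} {o : Pt d} {R : ℝ}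
    (hB : IsSEB (S : Set (Pt d)) o R) {ν : RatCurve d} {t₀ : ℝ} {F : Filter ℝ}
    (hF : IsSide t₀ F) (hν : ν.DefinedAt t₀) {a : ArcKind d}
    (h : ∀ᶠ t in F, ArcValid S o R ν a t) :
    (a.curve o ν).DefinedAt t₀ ∧
      ∃ r, IsSEB (insert (ν.point t₀) (S : Set (Pt d))) ((a.curve o ν).point t₀) r := by
  cases a with
  | inside =>
    refine ⟨RatCurve.const_definedAt o t₀, R, ?_⟩
    have := hF.neBot
    rw [ArcKind.curve, RatCurve.const_point]
    exact isSEB_insert_of_mem hB (Metric.isClosed_closedBall.mem_of_tendsto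
      ((RatCurve.continuousAt_point hν).tendsto.mono_left (hF.le.trans nhdsWithin_le_nhds))
      (h.mono fun t ht => Metric.ball_subset_closedBall ht))
  | outside S' => exact isSEB_of_isSupport hF hν h

lemma exists_isFirstArc {d : ℕ} {S : Finset (Pt d)} (hcard : 2 ≤ S.card) {o : Pt d} {R : ℝ}
    (hB : IsSEB (S : Set (Pt d)) o R) (ν : RatCurve d) : ∃ a, IsFirstArc S o R ν a := by
  rcases decides_mem_ball ν o (hB.radius_nonneg hcard) (isSide_right 0) with h | h
  · exact ⟨.inside, h⟩
  · by_contra! hno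
    have hall : ∀ᶠ t in 𝓝[>] (0 : ℝ), ∀ S' ∈ S.powerset, ¬ IsSupport S S' (ν.point t) :=
      (eventually_all_finset _).2 fun S' _ =>
        (decides_isSupport S S' ν (isSide_right 0)).resolve_left (hno (.outside S'))
    obtain ⟨t, ht, hall⟩ := (h.and hall).exists
    obtain ⟨S', hS'⟩ := exists_isSupport hcard hB ht
    exact hall S' (Finset.mem_powerset.2 hS'.1) hS'

/-- After a candidate of a valid arc that is not an IN-point, the mobile point is not in the
interior of the ball. -/
lemma eventually_notMem_ball {d : ℕ} {S : Finset (Pt d)} (hcard : 2 ≤ S.card) {o : Pt d}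
    {R : ℝ} (hB : IsSEB (S : Set (Pt d)) o R) {ν : RatCurve d} {t₀ : ℝ} (hν : ν.DefinedAt t₀)
    {a : ArcKind d} (hL : ∀ᶠ t in 𝓝[<] t₀, ArcValid S o R ν a t)
    (hcand : IsCandidate S o R ν a t₀) (hin : ¬ IsInPoint o R ν t₀) :
    ∀ᶠ t in 𝓝[>] t₀, ν.point t ∉ Metric.ball o R := by
  cases a with
  | inside => exact hcand.2.2.mono fun t ht h => ht (Metric.ball_subset_closedBall h)
  | outside S' =>
    have hR := hB.radius_nonneg hcard
    refine (decides_mem_ball ν o hR (isSide_right t₀)).resolve_left fun hball => hin ?_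
    have h := crossing hR hν (isSide_right t₀) (isSide_left t₀) hball
      (hL.mono fun t ht => IsSupport.notMem_ball hB ht)
    exact ⟨h.1, h.2, hball⟩

/-- An arc that is valid after `e` stays valid as long as no candidate occurs. -/
lemma eventually_arcValid_left {d : ℕ} {S : Finset (Pt d)} (hcard : 2 ≤ S.card) {o : Pt d}
    {R : ℝ} (hB : IsSEB (S : Set (Pt d)) o R) {ν : RatCurve d} {a : ArcKind d} {e τ : ℝ}
    (heτ : e ≤ τ) (hν : ∀ t ∈ Set.Icc e τ, ν.DefinedAt t)
    (he : ∀ᶠ t in 𝓝[>] e, ArcValid S o R ν a t)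
    (hcand : ∀ t ∈ Set.Ioo e τ, ¬ IsCandidate S o R ν a t) :
    ∀ t ∈ Set.Ioc e τ, ∀ᶠ u in 𝓝[<] t, ArcValid S o R ν a u := by
  have hdec : ∀ {t₀ F}, IsSide t₀ F → Decides F (ArcValid S o R ν a) :=
    fun hF => decides_arcValid S o (hB.radius_nonneg hcard) ν a hF
  let A : Set ℝ := {x | ∀ t ∈ Set.Ioc e x, ∀ᶠ u in 𝓝[<] t, ArcValid S o R ν a u}
  suffices h : Set.Icc e τ ⊆ A from h ⟨heτ, le_rfl⟩
  refine IsClosed.Icc_subset_of_forall_exists_gt ?_ ?_ ?_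
  · refine isClosed_of_closure_subset fun x hx => ?_
    have hxI : x ∈ Set.Icc e τ := closure_minimal Set.inter_subset_right isClosed_Icc hx
    have hlt : ∀ t ∈ Set.Ioo e x, ∀ᶠ u in 𝓝[<] t, ArcValid S o R ν a u := by
      intro t ht
      obtain ⟨y, hy, hyA, -⟩ := mem_closure_iff.1 hx (Set.Ioi t) isOpen_Ioi ht.2
      exact hyA t ⟨ht.1, le_of_lt hy⟩
    refine ⟨fun t ht => ?_, hxI⟩
    rcases ht.2.lt_or_eq with h | rfl
    · exact hlt t ⟨ht.1, h⟩
    · refine (hdec (isSide_left t)).resolve_right fun hbad => ?_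
      obtain ⟨u, hu, hsub⟩ := mem_nhdsLT_iff_exists_Ioo_subset.1 hbad
      obtain ⟨v, hv1, hv2⟩ := exists_between (max_lt (Set.mem_Iio.1 hu) ht.1)
      rw [max_lt_iff] at hv1
      obtain ⟨y, hy, hyv⟩ := ((hlt v ⟨hv1.2, hv2⟩).and (Ioo_mem_nhdsLT hv1.1)).exists
      exact hsub ⟨hyv.1, hyv.2.trans hv2⟩ hy
  · intro t ht
    exact absurd (ht.1.trans_le ht.2) (lt_irrefl _)
  · intro x ⟨hxA, hxe, hxτ⟩ y hy
    have hright : ∀ᶠ u in 𝓝[>] x, ArcValid S o R ν a u := by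
      rcases hxe.eq_or_lt with rfl | hlt
      · exact he
      · exact eventually_arcValid_right hcard hB (hν x ⟨hxe, hxτ.le⟩) (hxA x ⟨hlt, le_rfl⟩)
          (hcand x ⟨hlt, hxτ⟩)
    obtain ⟨u, hu, hsub⟩ := mem_nhdsGT_iff_exists_Ioo_subset.1 hright
    obtain ⟨z, hz1, hz2⟩ := exists_between (lt_min (Set.mem_Ioi.1 hu) (Set.mem_Ioi.1 hy))
    rw [lt_min_iff] at hz2
    refine ⟨z, fun t ht => ?_, hz1, hz2.2.le⟩
    rcases le_or_gt t x with h | h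
    · exact hxA t ⟨ht.1, h⟩
    · filter_upwards [Ioo_mem_nhdsLT h] with v hv
      exact hsub ⟨hv.1, hv.2.trans_le (ht.2.trans hz2.1.le)⟩

/-! ### Finiteness of the set of candidates -/

lemma finite_isIsolated {A : Set ℝ} (hA : ∀ t₀ F, IsSide t₀ F → Decides F (· ∈ A)) (a b : ℝ) :
    {t ∈ Set.Icc a b | IsIsolated A t}.Finite := by
  by_contra hinf
  obtain ⟨x, -, hx⟩ := Set.Infinite.exists_accPt_of_subset_isCompact hinf isCompact_Icc
    (Set.sep_subset _ _)
  rw [accPt_iff_frequently_nhdsNE] at hx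
  have hside : ∀ F, IsSide x F → ∀ᶠ t in F, ¬ IsIsolated A t := by
    intro F hF
    rcases hA x F hF with h | h
    · have h' : ∀ᶠ t in F, ∀ᶠ u in 𝓝 t, u ∈ A := by
        rcases hF with rfl | rfl
        · filter_upwards [eventually_eventually_nhdsWithin.2 h, self_mem_nhdsWithin] with t ht hs
          rwa [isOpen_Iio.nhdsWithin_eq hs] at ht
        · filter_upwards [eventually_eventually_nhdsWithin.2 h, self_mem_nhdsWithin] with t ht hs
          rwa [isOpen_Ioi.nhdsWithin_eq hs] at ht
      filter_upwards [h'] with t ht hiso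
      obtain ⟨u, hu, hu'⟩ := (hiso.2.and (ht.filter_mono nhdsWithin_le_nhds)).exists
      exact hu hu'
    · exact h.mono fun t ht hiso => ht hiso.1
  refine hx ?_
  rw [← nhdsLT_sup_nhdsGT, eventually_sup]
  exact ⟨(hside _ (isSide_left x)).mono fun t ht h => ht h.2,
    (hside _ (isSide_right x)).mono fun t ht h => ht h.2⟩

lemma decides_mem_sphere {d : ℕ} (ν : RatCurve d) (o : Pt d) {R : ℝ} (hR : 0 ≤ R) (t₀ : ℝ)
    (F : Filter ℝ) (hF : IsSide t₀ F) :
    Decides F (· ∈ {t | ν.point t ∈ Metric.sphere o R}) := by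
  rcases eventually_sphere_or ν o hR t₀ with h | h
  · exact Or.inl (hF.le h)
  · exact Or.inr (hF.le h)

lemma decides_curves_meet {d : ℕ} (γ δ : RatCurve d) (t₀ : ℝ) (F : Filter ℝ) (hF : IsSide t₀ F) :
    Decides F (· ∈ {t | γ.DefinedAt t ∧ δ.DefinedAt t ∧ γ.point t = δ.point t}) := by
  rcases (meromorphicAt_dist_sq γ δ t₀).eventually_eq_zero_or_eventually_ne_zero with h | h
  · refine Or.inl ?_
    filter_upwards [hF.le h, hF.le (γ.eventually_definedAt t₀), hF.le (δ.eventually_definedAt t₀)]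
      with t h1 h2 h3
    exact ⟨h2, h3, dist_eq_zero.1 (pow_eq_zero_iff two_ne_zero |>.1 h1)⟩
  · refine Or.inr ?_
    filter_upwards [hF.le h] with t ht hmeet
    exact ht (by rw [hmeet.2.2, dist_self]; norm_num)

lemma decides_mem_voronoiFace {d : ℕ} (γ : RatCurve d) (S P : Finset (Pt d)) (t₀ : ℝ)
    (F : Filter ℝ) (hF : IsSide t₀ F) :
    Decides F (· ∈ {t | γ.DefinedAt t ∧ γ.point t ∈ voronoiFace S P}) := by
  have hle : ∀ p q : Pt d, Decides F fun t => dist (γ.point t) p ≤ dist (γ.point t) q := by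
    intro p q
    simpa only [RatCurve.const_point] using
      decides_dist_le γ (RatCurve.const p) γ (RatCurve.const q) hF
  have hdef : Decides F γ.DefinedAt := Or.inl (hF.le (γ.eventually_definedAt t₀))
  refine hdef.and (Decides.and ?_ ?_)
  · exact Decides.forall_finset fun p _ => Decides.forall_finset fun q _ =>
      ((hle p q).and (hle q p)).congr (Eventually.of_forall fun t => le_antisymm_iff.symm)
  · refine Decides.forall_finset fun p _ => Decides.forall_finset fun l _ => ?_
    by_cases hl : l ∈ P
    · exact Or.inl (Eventually.of_forall fun t h => absurd hl h)
    · exact (hle p l).not.congr (Eventually.of_forall fun t => by simp [hl])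

lemma IsInPoint.isIsolated {d : ℕ} {o : Pt d} {R : ℝ} {ν : RatCurve d} {t : ℝ}
    (h : IsInPoint o R ν t) : IsIsolated {t | ν.point t ∈ Metric.sphere o R} t := by
  refine ⟨h.1, ?_⟩
  rw [← nhdsLT_sup_nhdsGT, eventually_sup]
  exact ⟨h.2.1.mono fun u hu hs => hu (Metric.sphere_subset_closedBall hs),
    h.2.2.mono fun u hu hs => (Metric.mem_ball.1 hu).ne hs⟩

lemma IsOutPoint.isIsolated {d : ℕ} {o : Pt d} {R : ℝ} {ν : RatCurve d} {t : ℝ}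
    (h : IsOutPoint o R ν t) : IsIsolated {t | ν.point t ∈ Metric.sphere o R} t := by
  refine ⟨h.1, ?_⟩
  rw [← nhdsLT_sup_nhdsGT, eventually_sup]
  exact ⟨h.2.1.mono fun u hu hs => (Metric.mem_ball.1 hu).ne hs,
    h.2.2.mono fun u hu hs => hu (Metric.sphere_subset_closedBall hs)⟩

/-- The candidates in `[0, T]` of all arcs that can occur. -/
def allCandidates {d : ℕ} (S : Finset (Pt d)) (o : Pt d) (R : ℝ) (ν : RatCurve d) (T : ℝ) :
    Set ℝ :=
  {t ∈ Set.Icc 0 T | IsCandidate S o R ν .inside t ∨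
    ∃ S' ⊆ S, IsCandidate S o R ν (.outside S') t}

lemma finite_allCandidates {d : ℕ} (S : Finset (Pt d)) (o : Pt d) {R : ℝ} (hR : 0 ≤ R)
    (ν : RatCurve d) (T : ℝ) : (allCandidates S o R ν T).Finite := by
  have h1 := finite_isIsolated (decides_mem_sphere ν o hR) 0 T
  have h2 : (⋃ S' ∈ S.powerset, ⋃ S'' ∈ S'.powerset, {t ∈ Set.Icc 0 T |
      CurvesMeetAt (circumcenterCurve S'' ν) (circumcenterCurve S' ν) t}).Finite :=
    S.powerset.finite_toSet.biUnion fun S' _ => S'.powerset.finite_toSet.biUnion fun S'' _ =>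
      finite_isIsolated (decides_curves_meet _ _) 0 T
  have h3 : (⋃ S' ∈ S.powerset, ⋃ P ∈ S.powerset, {t ∈ Set.Icc 0 T |
      CurveMeetsSetAt (circumcenterCurve S' ν) (voronoiFace S P) t}).Finite :=
    S.powerset.finite_toSet.biUnion fun S' _ => S.powerset.finite_toSet.biUnion fun P _ =>
      finite_isIsolated (decides_mem_voronoiFace _ S P) 0 T
  refine ((h1.union h2).union h3).subset ?_
  rintro t ⟨ht, h | ⟨S', hS', h | ⟨S'', -, hS'', h⟩ | ⟨P, -, hP, h⟩⟩⟩
  · exact Or.inl (Or.inl ⟨ht, IsOutPoint.isIsolated h⟩)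
  · exact Or.inl (Or.inl ⟨ht, h.isIsolated⟩)
  · refine Or.inl (Or.inr ?_)
    simp only [Set.mem_iUnion]
    exact ⟨S', Finset.mem_powerset.2 hS', S'', Finset.mem_powerset.2 hS''.1, ht, h⟩
  · refine Or.inr ?_
    simp only [Set.mem_iUnion]
    exact ⟨S', Finset.mem_powerset.2 hS', P, Finset.mem_powerset.2 hP, ht, h⟩

/-! ### Executions of the algorithm -/

/-- The perturbation parameter `ε` does not overstep a change: at each of the finitely many
candidates `t`, the time `t + ε` represents the times shortly after `t`. -/
def IsSmall {d : ℕ} (S : Finset (Pt d)) (o : Pt d) (R : ℝ) (ν : RatCurve d) (T ε : ℝ) : Prop :=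
  ∀ t ∈ allCandidates S o R ν T,
    (∀ S', IsSupport S S' (ν.point (t + ε)) → ∀ᶠ u in 𝓝[>] t, IsSupport S S' (ν.point u)) ∧
    ((∀ᶠ u in 𝓝[>] t, ν.point u ∉ Metric.ball o R) → ν.point (t + ε) ∉ Metric.ball o R)

lemma eventually_isSmall {d : ℕ} (S : Finset (Pt d)) (o : Pt d) {R : ℝ} (hR : 0 ≤ R)
    (ν : RatCurve d) (T : ℝ) : ∀ᶠ ε in 𝓝[>] (0 : ℝ), IsSmall S o R ν T ε := by
  have hshift : ∀ t : ℝ, Tendsto (fun ε => t + ε) (𝓝[>] 0) (𝓝[>] t) := fun t => by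
    refine tendsto_nhdsWithin_iff.2 ⟨?_, ?_⟩
    · have : Tendsto (fun ε => t + ε) (𝓝 0) (𝓝 (t + 0)) := tendsto_const_nhds.add tendsto_id
      rw [add_zero] at this
      exact this.mono_left nhdsWithin_le_nhds
    · filter_upwards [self_mem_nhdsWithin] with ε hε
      exact lt_add_of_pos_right t hε
  refine (eventually_all_finite (finite_allCandidates S o hR ν T)).2 fun t _ => Eventually.and ?_ ?_
  · have hall : ∀ᶠ ε in 𝓝[>] (0 : ℝ), ∀ S' ∈ S.powerset, IsSupport S S' (ν.point (t + ε)) →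
        ∀ᶠ u in 𝓝[>] t, IsSupport S S' (ν.point u) := by
      refine (eventually_all_finset _).2 fun S' _ => ?_
      rcases decides_isSupport S S' ν (isSide_right t) with h | h
      · exact Eventually.of_forall fun _ _ => h
      · exact ((hshift t).eventually h).mono fun ε hε h' => absurd h' hε
    exact hall.mono fun ε hε S' h => hε S' (Finset.mem_powerset.2 h.1) h
  · by_cases h : ∀ᶠ u in 𝓝[>] t, ν.point u ∉ Metric.ball o R
    · exact ((hshift t).eventually h).mono fun ε hε _ => hε
    · exact Eventually.of_forall fun ε h' => absurd h' h

lemma mem_allCandidates {d : ℕ} {S : Finset (Pt d)} {o : Pt d} {R T : ℝ} {ν : RatCurve d}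
    {e : ℝ × ArcKind d} {t : ℝ} (he : 0 ≤ e.1)
    (hv : ∀ᶠ t in 𝓝[>] e.1, ArcValid S o R ν e.2 t) (ht : t ∈ nextCandidates S o R ν T e) :
    t ∈ allCandidates S o R ν T := by
  refine ⟨⟨he.trans ht.1.1.le, ht.1.2⟩, ?_⟩
  obtain ⟨e, a⟩ := e
  cases a with
  | inside => exact Or.inl ht.2
  | outside S' =>
    obtain ⟨u, hu⟩ := hv.exists
    exact Or.inr ⟨S', hu.1, ht.2⟩

/-- The last arc of an execution is valid right after its event point. -/
lemma Execution.invariant {d : ℕ} {S : Finset (Pt d)} {o : Pt d} {R T ε : ℝ} (hT : 0 < T)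
    {ν : RatCurve d} (hε : IsSmall S o R ν T ε) {L : List (ℝ × ArcKind d)}
    (h : Execution S o R ν T ε L) :
    ∀ e l, L = e :: l → e.1 ∈ Set.Icc 0 T ∧ ∀ᶠ t in 𝓝[>] e.1, ArcValid S o R ν e.2 t := by
  induction h with
  | start a h =>
    rintro e l ⟨⟩
    exact ⟨⟨le_rfl, hT.le⟩, isFirstArc_iff.1 h⟩
  | step e l t a h ht ha ih =>
    rintro _ _ ⟨⟩
    obtain ⟨he, hv⟩ := ih e l rfl
    refine ⟨⟨he.1.trans ht.1.1.1.le, ht.1.1.2⟩, ?_⟩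
    cases a with
    | inside =>
      have ha : IsInPoint o R ν t := ha
      exact ha.2.2
    | outside S' => exact (hε t (mem_allCandidates he.1 hv ht.1)).1 S' ha.2

/-- The event points of an execution strictly increase and, except for `0`, are candidates. -/
lemma Execution.length_le {d : ℕ} {S : Finset (Pt d)} {o : Pt d} {R T ε : ℝ} (hR : 0 ≤ R)
    (hT : 0 < T) {ν : RatCurve d} (hε : IsSmall S o R ν T ε) {L : List (ℝ × ArcKind d)}
    (h : Execution S o R ν T ε L) :
    L.length ≤ (insert 0 (finite_allCandidates S o hR ν T).toFinset).card := by
  have key : (L.map Prod.fst).Pairwise (· > ·) ∧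
      ∀ t ∈ L.map Prod.fst, t ∈ insert 0 (finite_allCandidates S o hR ν T).toFinset := by
    induction h with
    | start a h => simp
    | step e l t a h ht ha ih =>
      obtain ⟨he, hv⟩ := h.invariant hT hε e l rfl
      have het : e.1 < t := ht.1.1.1
      have hmem := mem_allCandidates he.1 hv ht.1
      refine ⟨?_, ?_⟩
      · rw [List.map_cons, List.pairwise_cons]
        refine ⟨fun s hs => ?_, ih.1⟩
        rw [List.map_cons, List.mem_cons] at hs
        rcases hs with rfl | hs
        · exact het
        · exact lt_trans (List.rel_of_pairwise_cons ih.1 hs) het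
      · intro s hs
        rw [List.map_cons, List.mem_cons] at hs
        rcases hs with rfl | hs
        · simp [hmem]
        · exact ih.2 s hs
  have hnodup : (L.map Prod.fst).Nodup := key.1.imp fun h => ne_of_gt h
  calc L.length = (L.map Prod.fst).toFinset.card := by
        rw [List.toFinset_card_of_nodup hnodup, List.length_map]
    _ ≤ _ := Finset.card_le_card fun t ht => key.2 t (List.mem_toFinset.1 ht)

/-- A candidate exists only together with a next event point and a next arc: the candidates are
finitely many, and the mobile point has a support set where it is not inside the ball. -/
lemma Execution.exists_step {d : ℕ} {S : Finset (Pt d)} (hcard : 2 ≤ S.card) {o : Pt d}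
    {R T ε : ℝ} (hB : IsSEB (S : Set (Pt d)) o R) (hT : 0 < T) {ν : RatCurve d}
    (hν : ∀ t ∈ Set.Icc (0 : ℝ) T, ν.DefinedAt t) (hε : IsSmall S o R ν T ε)
    {e : ℝ × ArcKind d} {l : List (ℝ × ArcKind d)} (h : Execution S o R ν T ε (e :: l))
    (hne : (nextCandidates S o R ν T e).Nonempty) :
    ∃ t a, Execution S o R ν T ε ((t, a) :: e :: l) := by
  obtain ⟨he, hv⟩ := h.invariant hT hε e l rfl
  have hfin : (nextCandidates S o R ν T e).Finite :=
    (finite_allCandidates S o (hB.radius_nonneg hcard) ν T).subset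
      fun t ht => mem_allCandidates he.1 hv ht
  obtain ⟨t, ht, hmin⟩ := Set.exists_min_image _ id hfin hne
  have hleast : IsLeast (nextCandidates S o R ν T e) t := ⟨ht, hmin⟩
  have hsub : Set.Icc e.1 t ⊆ Set.Icc 0 T := Set.Icc_subset_Icc he.1 ht.1.2
  by_cases hin : IsInPoint o R ν t
  · exact ⟨t, .inside, .step e l t .inside h hleast hin⟩
  · have hL := eventually_arcValid_left hcard hB ht.1.1.le (fun u hu => hν u (hsub hu)) hv
      (fun u hu hc => absurd (hmin u ⟨⟨hu.1, hu.2.le.trans ht.1.2⟩, hc⟩) (not_le.2 hu.2))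
      t ⟨ht.1.1, le_rfl⟩
    have hout := eventually_notMem_ball hcard hB (hν t (hsub ⟨ht.1.1.le, le_rfl⟩)) hL ht.2 hin
    obtain ⟨S', hS'⟩ := exists_isSupport hcard hB
      ((hε t (mem_allCandidates he.1 hv ht)).2 hout)
    exact ⟨t, .outside S', .step e l t (.outside S') h hleast ⟨hin, hS'⟩⟩

/-- An execution describes the 1-center function up to the next candidate. -/
lemma Execution.isOneCenterEquation {d : ℕ} {S : Finset (Pt d)} (hcard : 2 ≤ S.card) {o : Pt d}
    {R T ε : ℝ} (hB : IsSEB (S : Set (Pt d)) o R) (hT : 0 < T) {ν : RatCurve d}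
    (hν : ∀ t ∈ Set.Icc (0 : ℝ) T, ν.DefinedAt t) (hε : IsSmall S o R ν T ε)
    {L : List (ℝ × ArcKind d)} (h : Execution S o R ν T ε L) :
    ∀ e l, L = e :: l → ∀ τ ∈ Set.Icc e.1 T, (∀ t ∈ Set.Ioo e.1 τ, ¬ IsCandidate S o R ν e.2 t) →
      IsOneCenterEquation S o ν τ L := by
  have arc : ∀ (e : ℝ × ArcKind d), e.1 ∈ Set.Icc 0 T →
      (∀ᶠ t in 𝓝[>] e.1, ArcValid S o R ν e.2 t) → ∀ τ ∈ Set.Icc e.1 T,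
      (∀ t ∈ Set.Ioo e.1 τ, ¬ IsCandidate S o R ν e.2 t) →
      ∀ t ∈ Set.Icc e.1 τ, (e.2.curve o ν).DefinedAt t ∧
        ∃ r, IsSEB (insert (ν.point t) (S : Set (Pt d))) ((e.2.curve o ν).point t) r := by
    intro e he hv τ hτ hc t ht
    have hdef : ∀ u ∈ Set.Icc e.1 τ, ν.DefinedAt u := fun u hu =>
      hν u ⟨he.1.trans hu.1, hu.2.trans hτ.2⟩
    rcases ht.1.eq_or_lt with heq | hlt
    · rw [← heq]
      exact isSEB_of_arcValid hB (isSide_right e.1) (hdef e.1 ⟨le_rfl, hτ.1⟩) hv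
    · exact isSEB_of_arcValid hB (isSide_left t) (hdef t ht)
        (eventually_arcValid_left hcard hB hτ.1 hdef hv hc t ⟨hlt, ht.2⟩)
  induction h with
  | start a h =>
    rintro e l ⟨⟩ τ hτ hc
    exact ⟨hτ.1, arc _ ⟨le_rfl, hT.le⟩ (isFirstArc_iff.1 h) τ hτ hc, rfl⟩
  | step e l t a h ht ha ih =>
    rintro _ _ ⟨⟩ τ hτ hc
    obtain ⟨he, hv⟩ := (h.step e l t a ht ha).invariant hT hε _ _ rfl
    refine ⟨hτ.1, arc _ he hv τ hτ hc, ih e l rfl t ⟨ht.1.1.1.le, ht.1.1.2⟩ fun u hu hcu => ?_⟩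
    exact absurd (ht.2 ⟨⟨hu.1, hu.2.le.trans ht.1.1.2⟩, hcu⟩) (not_le.2 hu.2)

end OneCenter

end

theorem theorem3 (d : ℕ) (hd : 2 ≤ d)
    -- the static points
    (S : Finset (OneCenter.Pt d)) (hcard : 2 ≤ S.card)
    (hS : OneCenter.GeneralPosition (S : Set (OneCenter.Pt d)))
    -- the smallest enclosing ball of the static points
    (o : OneCenter.Pt d) (R : ℝ) (hB : OneCenter.IsSEB (S : Set (OneCenter.Pt d)) o R)
    -- the motion of the mobile point on the time interval `[0, T]`
    (T : ℝ) (hT : 0 < T) (ν : OneCenter.RatCurve d)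
    (hν : ∀ t ∈ Set.Icc (0 : ℝ) T, ν.DefinedAt t) :
    -- the initialization is possible
    (∃ a, OneCenter.IsFirstArc S o R ν a) ∧
    -- and, for every sufficiently small perturbation parameter,
    ∃ ε₀ > (0 : ℝ), ∀ ε ∈ Set.Ioo 0 ε₀,
      -- every iteration can be carried out unless no further event point is found,
      (∀ e l, OneCenter.Execution S o R ν T ε (e :: l) →
        (OneCenter.nextCandidates S o R ν T e).Nonempty →
          ∃ t a, OneCenter.Execution S o R ν T ε ((t, a) :: e :: l)) ∧
      -- the number of iterations is bounded,
      (∃ N : ℕ, ∀ l, OneCenter.Execution S o R ν T ε l → l.length ≤ N) ∧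
      -- and the output at the end is the parametric equation of the 1-center function.
      (∀ e l, OneCenter.Execution S o R ν T ε (e :: l) →
        OneCenter.nextCandidates S o R ν T e = ∅ →
          OneCenter.IsOneCenterEquation S o ν T (e :: l)) := by
  have hR := hB.radius_nonneg hcard
  refine ⟨OneCenter.exists_isFirstArc hcard hB ν, ?_⟩
  obtain ⟨ε₀, hε₀, hsmall⟩ :=
    mem_nhdsGT_iff_exists_Ioo_subset.1 (OneCenter.eventually_isSmall S o hR ν T)
  refine ⟨ε₀, hε₀, fun ε hε => ?_⟩
  have hε' : OneCenter.IsSmall S o R ν T ε := hsmall hε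
  refine ⟨fun e l h hne => h.exists_step hcard hB hT hν hε' hne,
    ⟨_, fun l h => h.length_le hR hT hε'⟩, fun e l h hempty => ?_⟩
  have he := (h.invariant hT hε' e l rfl).1
  refine h.isOneCenterEquation hcard hB hT hν hε' e l rfl T ⟨he.2, le_rfl⟩ fun t ht hc => ?_
  have : t ∈ OneCenter.nextCandidates S o R ν T e := ⟨⟨ht.1, ht.2.le⟩, hc⟩
  rw [hempty] at this
  exact this
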